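/- Let $T>2$, let $\mathcal X$ be a measurable space with a probability measure $\mu$, let $P_0=\mu^{\otimes T}$ be the law under which $\mathbf X_T=(X_1,\dots,X_T)$ is i.i.d. with marginal law $\mu$, and let $h:\mathcal X^T\to\mathbb R$ be measurable and bounded. Write $E_0,\mathrm{Var}_0$ for expectation and variance under $P_0$. For probability laws put $\chi^2(P_1,P_2)=E_2\big(\tfrac{dP_1}{dP_2}-1\big)^2$ (equal to $\infty$ if $P_1\not\ll P_2$), and for a bivariate law $P$ with marginals $P_X,P_Y$ put $\phi^2(P)=\chi^2(P,P_X\times P_Y)$. A process is called $p$-dependent if for every $t$, conditionally on $X_t,\dots,X_{t+p-1}$, the past $(X_s)_{s<t}$ and the future $(X_s)_{s\ge t+p}$ are independent. For a law $P_f$ of $\mathbf X_T$ let $P_{\tilde f_1}$ be its 1-dependent counterpart, i.e. the law of the 1-dependent process with $P_{\tilde f_1}(x_{t-1},x_t)=P_f(x_{t-1},x_t)$ for all $t=2,\dots,T$, and put $$\phi_2^2(P_f(x_{t-2},x_{t-1},x_t))=\chi^2\big(P_f(x_{t-2},x_{t-1},x_t),\,P_{\tilde f_1}(x_{t-2},x_{t-1},x_t)\big).$$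 For $\eta_1,\eta_2\ge0$ consider the maximization (supremum) and the minimization (infimum) of $E_f[h(\mathbf X_T)]$ over all laws $P_f\ll P_0$ on $\mathcal X^T$ under which $(X_t)_{t=1,\dots,T}$ is a stationary 2-dependent process with marginal law $\mu$ and such that $\phi^2(P_f(x_{t-1},x_t))\le\eta_1$ for $t=2,\dots,T$ and $\phi_2^2(P_f(x_{t-2},x_{t-1},x_t))\le\eta_2$ for $t=3,\dots,T$. The set of attainable values is non-empty and bounded, and, as $(\eta_1,\eta_2)\to(0,0)$, $$\max E_f[h(\mathbf X_T)]\le E_0[h(\mathbf X_T)]+\sqrt{\mathrm{Var}_0(R(X,Y))\,\eta_1}+\sqrt{\mathrm{Var}_0(S(X,Y,Z))\,\eta_2}+o(\sqrt{\eta_1}+\sqrt{\eta_2}),$$ $$\min E_f[h(\mathbf X_T)]\ge E_0[h(\mathbf X_T)]-\sqrt{\mathrm{Var}_0(R(X,Y))\,\eta_1}-\sqrt{\mathrm{Var}_0(S(X,Y,Z))\,\eta_2}+o(\sqrt{\eta_1}+\sqrt{\eta_2}),$$ where $X,Y,Z$ are i.i.d. with law $\mu$, $$R(x,y)=\sum_{t=2}^TE_0[h(\mathbf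 X_T)|X_{t-1}=x,X_t=y]-\sum_{t=2}^TE_0[h(\mathbf X_T)|X_{t-1}=x]-\sum_{t=2}^TE_0[h(\mathbf X_T)|X_t=y]+(T-1)E_0[h(\mathbf X_T)],$$ $$S(x,y,z)=\sum_{t=3}^TE_0[h(\mathbf X_T)|X_{t-2}=x,X_{t-1}=y,X_t=z]-\sum_{t=3}^TE_0[h(\mathbf X_T)|X_{t-2}=x,X_{t-1}=y]-\sum_{t=3}^TE_0[h(\mathbf X_T)|X_{t-1}=y,X_t=z]+\sum_{t=3}^TE_0[h(\mathbf X_T)|X_{t-1}=y].$$ -/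

import Mathlib

open MeasureTheory ProbabilityTheory Topology

namespace SerialDependency

/-- The `χ²`-distance `χ²(P₁, P₂) = E₂ (dP₁/dP₂ - 1)²`, equal to `∞` when `P₁` is not absolutely
continuous with respect to `P₂`. -/
noncomputable def chiSq {α : Type*} [MeasurableSpace α] (P₁ P₂ : Measure α) : ENNReal :=
  open scoped Classical in
  if P₁ ≪ P₂ then ∫⁻ a, ENNReal.ofReal (((P₁.rnDeriv P₂ a).toReal - 1) ^ 2) ∂P₂ else ⊤

/-- The `φ²`-coefficient of a bivariate law: its `χ²`-distance to the product of its marginals. -/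
noncomputable def phiSq {α : Type*} [MeasurableSpace α] (ν : Measure (α × α)) : ENNReal :=
  chiSq ν ((ν.map Prod.fst).prod (ν.map Prod.snd))

/-- Conditional independence, under `P`, of the σ-algebras `m₁` and `m₂` given `m'`. -/
def CondIndepSigma {Ω : Type*} (m' m₁ m₂ : MeasurableSpace Ω) [MeasurableSpace Ω]
    (P : Measure Ω) : Prop :=
  ∀ A B : Set Ω, MeasurableSet[m₁] A → MeasurableSet[m₂] B →
    P[(A ∩ B).indicator (fun _ => (1 : ℝ)) | m'] =ᵐ[P]
      P[A.indicator (fun _ => (1 : ℝ)) | m'] * P[B.indicator (fun _ => (1 : ℝ)) | m']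

section Sequence

variable {𝒳 : Type*} [MeasurableSpace 𝒳] {T : ℕ}

/-- The law of `(X_i, X_j)` when the whole sequence has law `P`. -/
noncomputable def pairLaw (P : Measure (Fin T → 𝒳)) (i j : Fin T) : Measure (𝒳 × 𝒳) :=
  P.map (fun x => (x i, x j))

/-- The law of `(X_i, X_j, X_k)` when the whole sequence has law `P`. -/
noncomputable def tripleLaw (P : Measure (Fin T → 𝒳)) (i j k : Fin T) : Measure (𝒳 × 𝒳 × 𝒳) :=
  P.map (fun x => (x i, x j, x k))

/-- `p`-dependence (the Markov property of order `p`): for every `t`, given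
`X_t, …, X_{t+p-1}`, the past `(X_s)_{s < t}` and the future `(X_s)_{s ≥ t + p}` are
independent. -/
def IsDependent (p : ℕ) (P : Measure (Fin T → 𝒳)) : Prop :=
  ∀ t : ℕ, CondIndepSigma
    (cylinderEvents (X := fun _ : Fin T => 𝒳) {s | t ≤ (s : ℕ) ∧ (s : ℕ) < t + p})
    (cylinderEvents (X := fun _ : Fin T => 𝒳) {s | (s : ℕ) < t})
    (cylinderEvents (X := fun _ : Fin T => 𝒳) {s | t + p ≤ (s : ℕ)}) P

/-- Strict stationarity of a finite sequence: any `m` consecutive entries have the same joint law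
as the first `m` entries. -/
def IsStationary (P : Measure (Fin T → 𝒳)) : Prop :=
  ∀ (m s : ℕ) (hs : s + m ≤ T),
    P.map (fun x (i : Fin m) => x ⟨s + i, by omega⟩) =
      P.map (fun x (i : Fin m) => x ⟨i, by omega⟩)

/-- The law of an i.i.d. sequence of length `T` with marginal law `μ`. -/
noncomputable def baseline (μ : Measure 𝒳) (T : ℕ) : Measure (Fin T → 𝒳) :=
  Measure.pi (fun _ => μ)

/-- `Q` is the law of the 1-dependent counterpart of the process with law `P`: a 1-dependent
process with the same laws of pairs of consecutive states. (These laws determine `Q`.) -/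
structure IsOneDependentCounterpart (Q P : Measure (Fin T → 𝒳)) : Prop where
  isProbabilityMeasure : IsProbabilityMeasure Q
  isDependent : IsDependent 1 Q
  pairLaw_eq : ∀ i j : Fin T, (j : ℕ) = i + 1 → pairLaw Q i j = pairLaw P i j

/-- The feasible laws of the worst-case optimization with lag-one threshold `η₁` and lag-two
threshold `η₂`. -/
structure IsFeasible (μ : Measure 𝒳) (η₁ η₂ : ℝ) (P : Measure (Fin T → 𝒳)) : Prop where
  isProbabilityMeasure : IsProbabilityMeasure P
  lagOne : ∀ i j : Fin T, (j : ℕ) = i + 1 → phiSq (pairLaw P i j) ≤ ENNReal.ofReal η₁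
  lagTwo : ∃ Q : Measure (Fin T → 𝒳), IsOneDependentCounterpart Q P ∧
    ∀ i j k : Fin T, (j : ℕ) = i + 1 → (k : ℕ) = j + 1 →
      chiSq (tripleLaw P i j k) (tripleLaw Q i j k) ≤ ENNReal.ofReal η₂
  isDependent : IsDependent 2 P
  isStationary : IsStationary P
  marginal : ∀ i : Fin T, P.map (fun x => x i) = μ
  absolutelyContinuous : P ≪ baseline μ T

/-- The set of attainable values `E_f[h(X_1, …, X_T)]`, `P_f` feasible. -/
def values (μ : Measure 𝒳) (h : (Fin T → 𝒳) → ℝ) (η₁ η₂ : ℝ) : Set ℝ :=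
  {v | ∃ P : Measure (Fin T → 𝒳), IsFeasible μ η₁ η₂ P ∧ v = ∫ x, h x ∂P}

/-- Optimal value of the max formulation. -/
noncomputable def maxValue (μ : Measure 𝒳) (h : (Fin T → 𝒳) → ℝ) (η₁ η₂ : ℝ) : ℝ :=
  sSup (values μ h η₁ η₂)

/-- Optimal value of the min formulation. -/
noncomputable def minValue (μ : Measure 𝒳) (h : (Fin T → 𝒳) → ℝ) (η₁ η₂ : ℝ) : ℝ :=
  sInf (values μ h η₁ η₂)

/-- `E₀[h]`, the expectation under the i.i.d. baseline. -/
noncomputable def E0 (μ : Measure 𝒳) (h : (Fin T → 𝒳) → ℝ) : ℝ :=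
  ∫ w, h w ∂(baseline μ T)

/-- `E₀[h | X_i = x]`: under the i.i.d. baseline, the coordinate `i` is fixed and the others are
averaged out. -/
noncomputable def condE1 (μ : Measure 𝒳) (h : (Fin T → 𝒳) → ℝ) (i : Fin T) (x : 𝒳) : ℝ :=
  E0 μ (fun w => h (Function.update w i x))

/-- `E₀[h | X_i = x, X_j = y]` for `i ≠ j`. -/
noncomputable def condE2 (μ : Measure 𝒳) (h : (Fin T → 𝒳) → ℝ) (i j : Fin T) (x y : 𝒳) : ℝ :=
  E0 μ (fun w => h (Function.update (Function.update w i x) j y))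

/-- `E₀[h | X_i = x, X_j = y, X_k = z]` for distinct `i, j, k`. -/
noncomputable def condE3 (μ : Measure 𝒳) (h : (Fin T → 𝒳) → ℝ) (i j k : Fin T) (x y z : 𝒳) : ℝ :=
  E0 μ (fun w => h (Function.update (Function.update (Function.update w i x) j y) k z))

/-- The two-variable interaction function `R`; the consecutive pair at `t : Fin (T - 1)` is
`(X_t, X_{t+1})` with indices counted from `0`. -/
noncomputable def R (μ : Measure 𝒳) (h : (Fin T → 𝒳) → ℝ) (x y : 𝒳) : ℝ :=
  (∑ t : Fin (T - 1), condE2 μ h ⟨t, by omega⟩ ⟨t + 1, by omega⟩ x y)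
    - (∑ t : Fin (T - 1), condE1 μ h ⟨t, by omega⟩ x)
    - (∑ t : Fin (T - 1), condE1 μ h ⟨t + 1, by omega⟩ y)
    + ((T : ℝ) - 1) * E0 μ h

/-- The three-variable interaction function `S`; the consecutive triple at `t : Fin (T - 2)` is
`(X_t, X_{t+1}, X_{t+2})` with indices counted from `0`. -/
noncomputable def S (μ : Measure 𝒳) (h : (Fin T → 𝒳) → ℝ) (x y z : 𝒳) : ℝ :=
  (∑ t : Fin (T - 2),
      condE3 μ h ⟨t, by omega⟩ ⟨t + 1, by omega⟩ ⟨t + 2, by omega⟩ x y z)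
    - (∑ t : Fin (T - 2), condE2 μ h ⟨t, by omega⟩ ⟨t + 1, by omega⟩ x y)
    - (∑ t : Fin (T - 2), condE2 μ h ⟨t + 1, by omega⟩ ⟨t + 2, by omega⟩ y z)
    + (∑ t : Fin (T - 2), condE1 μ h ⟨t + 1, by omega⟩ y)

/-- `Var₀(R(X, Y))` for `X, Y` i.i.d. with law `μ`. -/
noncomputable def varR (μ : Measure 𝒳) (h : (Fin T → 𝒳) → ℝ) : ℝ :=
  variance (fun p : 𝒳 × 𝒳 => R μ h p.1 p.2) (μ.prod μ)

/-- `Var₀(S(X, Y, Z))` for `X, Y, Z` i.i.d. with law `μ`. -/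
noncomputable def varS (μ : Measure 𝒳) (h : (Fin T → 𝒳) → ℝ) : ℝ :=
  variance (fun p : 𝒳 × 𝒳 × 𝒳 => S μ h p.1 p.2.1 p.2.2) (μ.prod (μ.prod μ))

end Sequence

end SerialDependency

/-! A feasible law `P` is a stationary chain of order two, so its density with respect to the i.i.d.
law is a product of pair factors `L (x i) (x (i+1))` and triple factors `V (x j) (x (j+1)) (x
(j+2))`. Here `L` is the density of the pair law with respect to `μ.prod μ`, and `V` is the density
of the triple law with respect to that of the Markov chain driven by `L`. The two constraints say
that `L - 1` and `V - 1` have squared norms at most `η₁` in `L²(μ.prod μ)` and `η₂` in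
`L²(markovTriple μ L)`.

Products of several `L - 1` need not be square integrable, so the density is not expanded. Instead
the factors are inserted one at a time, giving the laws `hybrid`. The order of insertion is what
matters: when a pair factor enters, the pair it concerns has law exactly `μ.prod μ`
(`pairLaw_hybrid`), and when a triple factor enters, its triple has exactly the Markov law
(`tripleLaw_hybrid`). Each insertion therefore changes a bounded expectation by at most its supremum
bound times `√η₁` or `√η₂`, and every hybrid law is close to the i.i.d. law on bounded functions.
After the last insertion the law is `P` (`hybrid_full`).

An insertion into a law `A` contributes `∫ (L - 1) h ∂A`. Replacing `h` by its i.i.d. conditional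
expectation given the pair costs `√η₁` times the norm of the `A`-conditional expectation of the
difference. That squared norm is the `A`-integral of a bounded function whose i.i.d. integral is
zero, hence small by closeness (`abs_integral_mul_sub_condExp_le`). Triple insertions are treated
alike.

The leading terms integrate `L - 1` against sums of `condE2` and `V - 1` against sums of `condE3`.
Since inserting `L` preserves both marginals and inserting `V` preserves both pair laws, these
perturbations are orthogonal to functions of fewer variables. Subtracting such functions leaves `R`
and `S` centred, and Cauchy–Schwarz gives the two square roots. The remainder is of order `(√η₁ +
√η₂) ^ (3/2)`, uniformly over feasible laws, which settles both extrema. -/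

namespace SerialDependency

/-! ### Conditional independence on events and mean-square estimates -/

open scoped ENNReal

/-- A version `w` of the conditional probability of `B` given `m'` stays valid when the `m₁`-event
`A` is added to the conditioning: factor the conditional probability of `A ∩ B` and pull `w` back
inside. This turns `IsDependent` into a `lintegral` identity into which an explicit transition
density can be substituted for `w`. -/
lemma CondIndepSigma.measure_inter_inter {Ω : Type*} {m' m₁ m₂ : MeasurableSpace Ω}
    [mΩ : MeasurableSpace Ω] {P : Measure Ω} [IsProbabilityMeasure P] (hm' : m' ≤ mΩ)
    (hm₁ : m₁ ≤ mΩ) (hm₂ : m₂ ≤ mΩ) (hP : CondIndepSigma m' m₁ m₂ P) {A B D : Set Ω}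
    (hA : MeasurableSet[m₁] A) (hB : MeasurableSet[m₂] B) (hD : MeasurableSet[m'] D)
    {w : Ω → ℝ≥0∞} (hw : Measurable[m'] w)
    (hwB : ∀ E, MeasurableSet[m'] E → P (E ∩ B) = ∫⁻ x in E, w x ∂P) :
    P (A ∩ D ∩ B) = ∫⁻ x in A ∩ D, w x ∂P := by
  have hA' := hm₁ _ hA
  have hB' := hm₂ _ hB
  have hD' := hm' _ hD
  have hw' : Measurable w := hw.mono hm' le_rfl
  have hfin : ∫⁻ x, w x ∂P ≠ ∞ := by
    have := hwB Set.univ MeasurableSet.univ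
    rw [Measure.restrict_univ] at this
    rw [← this]; exact measure_ne_top _ _
  have hlt : ∀ᵐ x ∂P, w x < ∞ := ae_lt_top hw' hfin
  have hint : Integrable (fun x => (w x).toReal) P := integrable_toReal_of_lintegral_ne_top
    hw'.aemeasurable hfin
  have hmr : StronglyMeasurable[m'] (fun x => (w x).toReal) := by
    apply Measurable.stronglyMeasurable
    exact hw.ennreal_toReal
  have hsetint : ∀ E : Set Ω, MeasurableSet E →
      ∫ x in E, (w x).toReal ∂P = (∫⁻ x in E, w x ∂P).toReal := fun E _ =>
    integral_toReal hw'.aemeasurable (ae_restrict_of_ae hlt)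
  have hBc : (fun x => (w x).toReal) =ᵐ[P] P[B.indicator (fun _ => (1 : ℝ)) | m'] := by
    refine ae_eq_condExp_of_forall_setIntegral_eq hm' ((integrable_const _).indicator hB')
      (fun _ _ _ => hint.integrableOn) (fun E hE _ => ?_) hmr.aestronglyMeasurable
    rw [hsetint E (hm' _ hE), ← hwB E hE, setIntegral_indicator hB']
    simp [Measure.real]
  have hI : Integrable ((A.indicator (fun _ => (1 : ℝ))) * (fun x => (w x).toReal)) P := by
    refine (hint.indicator hA').congr (ae_of_all _ fun x => ?_)
    by_cases hx : x ∈ A <;> simp [hx]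
  have hI2 : Integrable ((fun x => (w x).toReal) * (A.indicator (fun _ => (1 : ℝ)))) P := by
    rw [mul_comm]; exact hI
  have key : ∫ x in D, (A ∩ B).indicator (fun _ => (1 : ℝ)) x ∂P
      = ∫ x in D, (A.indicator (fun _ => (1 : ℝ)) * (fun x => (w x).toReal)) x ∂P := by
    rw [← setIntegral_condExp hm' ((integrable_const _).indicator (hA'.inter hB')) hD,
      ← setIntegral_condExp hm' hI hD]
    refine integral_congr_ae (ae_restrict_of_ae ?_)
    have h2 := condExp_mul_of_stronglyMeasurable_left hmr hI2
      ((integrable_const (1 : ℝ)).indicator hA')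
    rw [mul_comm] at h2
    filter_upwards [hP A B hA hB, hBc, h2] with x h1 h3 h4
    rw [h1, h4, Pi.mul_apply, Pi.mul_apply, ← h3, mul_comm]
  have e1 : ∫ x in D, (A ∩ B).indicator (fun _ => (1 : ℝ)) x ∂P = (P (A ∩ D ∩ B)).toReal := by
    rw [setIntegral_indicator (hA'.inter hB')]
    have : D ∩ (A ∩ B) = A ∩ D ∩ B := by ext; simp; tauto
    simp [Measure.real, this]
  have e2 : ∫ x in D, (A.indicator (fun _ => (1 : ℝ)) * (fun x => (w x).toReal)) x ∂P
      = (∫⁻ x in A ∩ D, w x ∂P).toReal := by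
    have : ∀ x, (A.indicator (fun _ => (1 : ℝ)) * (fun x => (w x).toReal)) x
        = A.indicator (fun x => (w x).toReal) x := fun x => by
      by_cases hx : x ∈ A <;> simp [hx]
    simp_rw [this]
    rw [setIntegral_indicator hA', Set.inter_comm, hsetint _ (hA'.inter hD')]
  rw [e1, e2] at key
  refine (ENNReal.toReal_eq_toReal_iff' (measure_ne_top _ _) ?_).1 key
  exact ((setLIntegral_le_lintegral _ _).trans_lt hfin.lt_top).ne

lemma abs_integral_mul_le_sqrt {Ω : Type*} [MeasurableSpace Ω] {A : Measure Ω} {f g : Ω → ℝ}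
    (hf : MemLp f 2 A) (hg : MemLp g 2 A) :
    |∫ x, f x * g x ∂A| ≤ √(∫ x, f x ^ 2 ∂A) * √(∫ x, g x ^ 2 ∂A) := by
  have h := integral_mul_le_Lp_mul_Lq_of_nonneg (μ := A) Real.HolderConjugate.two_two
    (f := fun x => |f x|) (g := fun x => |g x|) (ae_of_all _ fun _ => abs_nonneg _)
    (ae_of_all _ fun _ => abs_nonneg _) (by rw [ENNReal.ofReal_ofNat]; exact hf.abs)
    (by rw [ENNReal.ofReal_ofNat]; exact hg.abs)
  calc |∫ x, f x * g x ∂A| ≤ ∫ x, |f x * g x| ∂A := abs_integral_le_integral_abs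
    _ = ∫ x, |f x| * |g x| ∂A := by simp_rw [abs_mul]
    _ ≤ _ := h
    _ = _ := by
      simp only [Real.rpow_two, sq_abs, Real.sqrt_eq_rpow]

/-- If `A` is `δ`-close to `P₀` on bounded functions and `c ∘ π` is the conditional expectation of
`h` given `π` under `P₀`, then `h` may be replaced by `c ∘ π` when integrating against
square-integrable functions of `π` under `A`. -/
lemma abs_integral_mul_sub_condExp_le {Ω E : Type*} [MeasurableSpace Ω] [MeasurableSpace E]
    {A P₀ : Measure Ω} [IsProbabilityMeasure A] [IsProbabilityMeasure P₀]
    {π : Ω → E} (hπ : Measurable π) {u : E → ℝ} (hu : Measurable u)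
    (huL : MemLp (fun x => u (π x)) 2 A) {η : ℝ} (huη : ∫ x, u (π x) ^ 2 ∂A ≤ η)
    {h : Ω → ℝ} (hh : Measurable h) {C : ℝ} (hC : ∀ x, |h x| ≤ C)
    {c : E → ℝ} (hc : Measurable c) (hcC : ∀ e, |c e| ≤ C)
    (hproj : ∀ φ : E → ℝ, Measurable φ → (∀ e, |φ e| ≤ 2 * C) →
      ∫ x, φ (π x) * (h x - c (π x)) ∂P₀ = 0)
    {δ : ℝ} (hδ : ∀ f : Ω → ℝ, Measurable f → ∀ K : ℝ, (∀ x, |f x| ≤ K) →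
      |∫ x, f x ∂A - ∫ x, f x ∂P₀| ≤ K * δ) :
    |∫ x, u (π x) * (h x - c (π x)) ∂A| ≤ √η * (2 * C * √δ) := by
  have hC0 : 0 ≤ C := by
    have : Nonempty Ω := A.nonempty_of_neZero
    exact (abs_nonneg _).trans (hC this.some)
  set d : Ω → ℝ := fun x => h x - c (π x) with hd
  have hdm : Measurable d := hh.sub (hc.comp hπ)
  have hdb : ∀ x, |d x| ≤ 2 * C := fun x => by
    calc |d x| ≤ |h x| + |c (π x)| := abs_sub _ _
      _ ≤ 2 * C := by linarith [hC x, hcC (π x)]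
  have hdi : Integrable d A := Integrable.of_bound hdm.aestronglyMeasurable (2 * C)
    (ae_of_all _ hdb)
  have hm : MeasurableSpace.comap π inferInstance ≤ (inferInstance : MeasurableSpace Ω) :=
    hπ.comap_le
  set g := A[d | MeasurableSpace.comap π inferInstance] with hg
  have hgm : Measurable[MeasurableSpace.comap π inferInstance] g :=
    stronglyMeasurable_condExp.measurable
  obtain ⟨φ₀, hφ₀, hgφ₀⟩ := hgm.exists_eq_measurable_comp
  -- The factorization `φ₀` is uncontrolled outside values that matter almost surely; clamping gives
  -- the everywhere bound that `hproj` requires.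
  set φ : E → ℝ := fun e => max (-(2 * C)) (min (2 * C) (φ₀ e)) with hφ
  have hφm : Measurable φ := measurable_const.max (measurable_const.min hφ₀)
  have hφb : ∀ e, |φ e| ≤ 2 * C := fun e => by
    rw [abs_le]
    exact ⟨le_max_left _ _, max_le (by linarith) (min_le_left _ _)⟩
  have hgφ : g =ᵐ[A] fun x => φ (π x) := by
    have := ae_bdd_abs_condExp_of_ae_bdd_abs (m := MeasurableSpace.comap π inferInstance)
      (ae_of_all A hdb)
    filter_upwards [this] with x hx
    have hx' : |g x| ≤ 2 * C := hx
    have e : g x = φ₀ (π x) := congrFun hgφ₀ x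
    rw [e, abs_le] at hx'
    rw [e, hφ]
    simp only
    rw [min_eq_right hx'.2, max_eq_right hx'.1]
  have pull : ∀ v : E → ℝ, Measurable v → MemLp (fun x => v (π x)) 2 A →
      ∫ x, v (π x) * d x ∂A = ∫ x, v (π x) * φ (π x) ∂A := by
    intro v hv hvL
    have hdL : MemLp d 2 A := MemLp.of_bound hdm.aestronglyMeasurable (2 * C) (ae_of_all _ hdb)
    have hvm : StronglyMeasurable[MeasurableSpace.comap π inferInstance] (fun x => v (π x)) :=
      (hv.comp (comap_measurable π)).stronglyMeasurable
    have hI : Integrable ((fun x => v (π x)) * d) A := hvL.integrable_mul hdL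
    have h2 := condExp_mul_of_stronglyMeasurable_left hvm hI hdi
    have h3 := integral_condExp (μ := A) (f := (fun x => v (π x)) * d) hm
    calc ∫ x, v (π x) * d x ∂A = ∫ x, ((fun x => v (π x)) * d) x ∂A := rfl
      _ = _ := h3.symm
      _ = _ := integral_congr_ae (by
        filter_upwards [h2, hgφ] with x h4 h5
        rw [h4, Pi.mul_apply, ← h5])
  have hφL : MemLp (fun x => φ (π x)) 2 A :=
    MemLp.of_bound (hφm.comp hπ).aestronglyMeasurable (2 * C) (ae_of_all _ fun x => hφb _)
  -- By `pull` the squared norm is the `A`-integral of `φ (π x) * d x`, a function bounded by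
  -- `(2C)²` whose `P₀`-integral is zero.
  have hsq : ∫ x, φ (π x) ^ 2 ∂A ≤ (2 * C) ^ 2 * δ := by
    have h1 := pull φ hφm hφL
    have h2 := hδ (fun x => φ (π x) * d x) ((hφm.comp hπ).mul hdm) ((2 * C) ^ 2) (fun x => by
      rw [abs_mul, pow_two]
      exact mul_le_mul (hφb _) (hdb x) (abs_nonneg _) (by linarith))
    rw [hproj φ hφm hφb, sub_zero, h1] at h2
    simp_rw [pow_two (φ _)]
    exact (le_abs_self _).trans h2
  rw [show ∫ x, u (π x) * (h x - c (π x)) ∂A = ∫ x, u (π x) * d x ∂A from rfl, pull u hu huL]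
  refine (abs_integral_mul_le_sqrt huL hφL).trans ?_
  refine mul_le_mul (Real.sqrt_le_sqrt huη) ?_ (Real.sqrt_nonneg _) (Real.sqrt_nonneg _)
  refine (Real.sqrt_le_sqrt hsq).trans_eq ?_
  rw [Real.sqrt_mul (by positivity), Real.sqrt_sq (by linarith)]

/-- Change of a bounded expectation under a density close to one in mean square. -/
lemma abs_integral_withDensity_sub_le {Ω : Type*} [MeasurableSpace Ω]
    {A : Measure Ω} [IsProbabilityMeasure A] {v : Ω → NNReal} (hv : Measurable v)
    (hvL : MemLp (fun x => (v x : ℝ) - 1) 2 A) {η : ℝ} (hη : ∫ x, ((v x : ℝ) - 1) ^ 2 ∂A ≤ η)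
    {f : Ω → ℝ} (hf : Measurable f) {K : ℝ} (hK : ∀ x, |f x| ≤ K) :
    ∫ x, f x ∂(A.withDensity fun x => (v x : ℝ≥0∞)) - ∫ x, f x ∂A
        = ∫ x, ((v x : ℝ) - 1) * f x ∂A ∧
      |∫ x, f x ∂(A.withDensity fun x => (v x : ℝ≥0∞)) - ∫ x, f x ∂A| ≤ K * √η := by
  have hK0 : 0 ≤ K := by
    have : Nonempty Ω := A.nonempty_of_neZero
    exact (abs_nonneg _).trans (hK this.some)
  have hfL : MemLp f 2 A := MemLp.of_bound hf.aestronglyMeasurable K (ae_of_all _ hK)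
  have e : ∫ x, f x ∂(A.withDensity fun x => (v x : ℝ≥0∞)) - ∫ x, f x ∂A
        = ∫ x, ((v x : ℝ) - 1) * f x ∂A := by
    have hI : Integrable (fun x => ((v x : ℝ) - 1) * f x) A := hvL.integrable_mul hfL
    have hfi : Integrable f A := hfL.integrable (by norm_num)
    rw [integral_withDensity_eq_integral_smul hv, sub_eq_iff_eq_add, ← integral_add hI hfi]
    refine integral_congr_ae (ae_of_all _ fun x => ?_)
    simp only [NNReal.smul_def, smul_eq_mul]
    ring
  refine ⟨e, ?_⟩
  rw [e]
  refine (abs_integral_mul_le_sqrt hvL hfL).trans ?_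
  rw [mul_comm]
  refine mul_le_mul ?_ (Real.sqrt_le_sqrt hη) (Real.sqrt_nonneg _) hK0
  refine Real.sqrt_le_iff.2 ⟨hK0, ?_⟩
  calc ∫ x, f x ^ 2 ∂A ≤ ∫ _, K ^ 2 ∂A := by
        refine integral_mono_of_nonneg (ae_of_all _ fun _ => sq_nonneg _) (integrable_const _)
          (ae_of_all _ fun x => ?_)
        exact sq_le_sq' (abs_le.1 (hK x)).1 (abs_le.1 (hK x)).2
    _ = K ^ 2 := by simp

/-! ### Resampling coordinates of the i.i.d. law -/

section Resampling

variable {𝒳 : Type*} [MeasurableSpace 𝒳] (μ : Measure 𝒳) [IsProbabilityMeasure μ] {T : ℕ}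

instance isProbabilityMeasure_baseline : IsProbabilityMeasure (baseline μ T) := by
  unfold baseline; infer_instance

/-- On a box, the constraint at `j` passes to the fresh variable and the old coordinate becomes
free. Integrating out one coordinate, finding joint laws of coordinates and interpreting `condE2`
and `condE3` as conditional expectations all rest on this. -/
lemma measurePreserving_update (j : Fin T) :
    MeasurePreserving (fun p : (Fin T → 𝒳) × 𝒳 => Function.update p.1 j p.2)
      ((baseline μ T).prod μ) (baseline μ T) := by
  refine ⟨measurable_update', (Measure.pi_eq fun s hs => ?_).symm⟩
  rw [Measure.map_apply measurable_update' (MeasurableSet.univ_pi hs)]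
  have : (fun p : (Fin T → 𝒳) × 𝒳 => Function.update p.1 j p.2) ⁻¹' (Set.univ.pi s)
      = (Set.univ.pi (Function.update s j Set.univ)) ×ˢ s j := by
    ext p
    simp only [Set.mem_preimage, Set.mem_pi, Set.mem_univ, true_implies, Set.mem_prod]
    constructor
    · intro h
      refine ⟨fun i => ?_, by simpa using h j⟩
      by_cases hi : i = j
      · subst hi; simp
      · simpa [hi] using h i
    · rintro ⟨h1, h2⟩ i
      by_cases hi : i = j
      · subst hi; simpa using h2
      · simpa [hi] using h1 i
  rw [this, Measure.prod_prod, baseline, Measure.pi_pi,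
    ← Finset.mul_prod_erase Finset.univ (fun i => μ (s i)) (Finset.mem_univ j),
    ← Finset.mul_prod_erase Finset.univ (fun i => μ (Function.update s j Set.univ i))
      (Finset.mem_univ j), mul_comm]
  simp only [Function.update_self, measure_univ, one_mul]
  congr 1
  refine Finset.prod_congr rfl fun i hi => ?_
  rw [Function.update_of_ne (Finset.ne_of_mem_erase hi)]

lemma measurePreserving_update₂ (i j : Fin T) :
    MeasurePreserving (fun p : (Fin T → 𝒳) × (𝒳 × 𝒳) =>
      Function.update (Function.update p.1 i p.2.1) j p.2.2)
      ((baseline μ T).prod (μ.prod μ)) (baseline μ T) :=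
  ((measurePreserving_update μ j).comp
    ((measurePreserving_update μ i).prod (MeasurePreserving.id μ))).comp
    (measurePreserving_prodAssoc (baseline μ T) μ μ).symm

lemma measurePreserving_update₃ (i j k : Fin T) :
    MeasurePreserving (fun p : (Fin T → 𝒳) × (𝒳 × 𝒳 × 𝒳) =>
      Function.update (Function.update (Function.update p.1 i p.2.1) j p.2.2.1) k p.2.2.2)
      ((baseline μ T).prod (μ.prod (μ.prod μ))) (baseline μ T) :=
  ((measurePreserving_update₂ μ j k).comp
    ((measurePreserving_update μ i).prod (MeasurePreserving.id (μ.prod μ)))).comp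
    (measurePreserving_prodAssoc (baseline μ T) μ (μ.prod μ)).symm

lemma lintegral_baseline_update (j : Fin T) {F : (Fin T → 𝒳) → ℝ≥0∞} (hF : Measurable F) :
    ∫⁻ x, F x ∂(baseline μ T) = ∫⁻ x, ∫⁻ z, F (Function.update x j z) ∂μ ∂(baseline μ T) := by
  rw [← (measurePreserving_update μ j).lintegral_comp hF, lintegral_prod]
  exact (hF.comp measurable_update').aemeasurable

/-- A factor that integrates to one over a coordinate on which the other factor does not depend
may be dropped. -/
lemma lintegral_baseline_mul_eq (j : Fin T) {G w : (Fin T → 𝒳) → ℝ≥0∞} (hG : Measurable G)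
    (hw : Measurable w) (hGj : ∀ x z, G (Function.update x j z) = G x)
    (hwj : ∀ x, ∫⁻ z, w (Function.update x j z) ∂μ = 1) :
    ∫⁻ x, G x * w x ∂(baseline μ T) = ∫⁻ x, G x ∂(baseline μ T) := by
  rw [lintegral_baseline_update μ j (F := fun x => G x * w x) (by fun_prop)]
  refine lintegral_congr fun x => ?_
  simp_rw [hGj]
  rw [lintegral_const_mul (G x) (f := fun z => w (Function.update x j z))
    (hw.comp (measurable_update x)), hwj, mul_one]

lemma map_eval_pair_baseline {i j : Fin T} (hij : i ≠ j) :
    pairLaw (baseline μ T) i j = μ.prod μ := by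
  have hm : Measurable fun x : Fin T → 𝒳 => (x i, x j) := by fun_prop
  rw [pairLaw, ← (measurePreserving_update₂ μ i j).map_eq,
    Measure.map_map hm (measurePreserving_update₂ μ i j).measurable]
  have : (fun x : Fin T → 𝒳 => (x i, x j)) ∘ (fun p : (Fin T → 𝒳) × (𝒳 × 𝒳) =>
      Function.update (Function.update p.1 i p.2.1) j p.2.2) = Prod.snd := by
    ext p <;> simp [hij]
  rw [this, measurePreserving_snd.map_eq]

lemma map_eval_triple_baseline {i j k : Fin T} (hij : i ≠ j) (hik : i ≠ k) (hjk : j ≠ k) :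
    tripleLaw (baseline μ T) i j k = μ.prod (μ.prod μ) := by
  have hm : Measurable fun x : Fin T → 𝒳 => (x i, x j, x k) := by fun_prop
  rw [tripleLaw, ← (measurePreserving_update₃ μ i j k).map_eq,
    Measure.map_map hm (measurePreserving_update₃ μ i j k).measurable]
  have : (fun x : Fin T → 𝒳 => (x i, x j, x k)) ∘ (fun p : (Fin T → 𝒳) × (𝒳 × 𝒳 × 𝒳) =>
      Function.update (Function.update (Function.update p.1 i p.2.1) j p.2.2.1) k p.2.2.2)
      = Prod.snd := by
    ext p <;> simp [hij, hik, hjk]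
  rw [this, measurePreserving_snd.map_eq]

end Resampling

/-! ### Products of transition densities and the hybrid laws -/

section Chain

variable {𝒳 : Type*} [MeasurableSpace 𝒳] {T : ℕ} [NeZero T]

/-- `L` is the transition density of a stationary Markov chain with marginal law `μ`, and `V`
modifies it into the transition density `L y z * V x y z` of a Markov chain of order two. -/
structure IsTransition (μ : Measure 𝒳) (L : 𝒳 → 𝒳 → NNReal) (V : 𝒳 → 𝒳 → 𝒳 → NNReal) :
    Prop where
  measL : Measurable fun p : 𝒳 × 𝒳 => L p.1 p.2
  measV : Measurable fun p : 𝒳 × 𝒳 × 𝒳 => V p.1 p.2.1 p.2.2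
  -- The normalizations hold at every point, so coordinates can be integrated out without tracking
  -- null sets; the densities are adjusted on null sets to achieve this.
  right : ∀ x, ∫⁻ z, L x z ∂μ = 1
  left : ∀ z, ∫⁻ x, L x z ∂μ = 1
  two : ∀ x y, ∫⁻ z, (L y z : ℝ≥0∞) * V x y z ∂μ = 1

/-- The product of the first `k` factors `L (x i) (x (i + 1))`. -/
def pairProd (L : 𝒳 → 𝒳 → NNReal) (k : ℕ) (x : Fin T → 𝒳) : NNReal :=
  ∏ i ∈ Finset.range k, L (x (Fin.ofNat T i)) (x (Fin.ofNat T (i + 1)))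

/-- The product of the first `m` factors `V (x j) (x (j + 1)) (x (j + 2))`. -/
def tripleProd (V : 𝒳 → 𝒳 → 𝒳 → NNReal) (m : ℕ) (x : Fin T → 𝒳) : NNReal :=
  ∏ j ∈ Finset.range m,
    V (x (Fin.ofNat T j)) (x (Fin.ofNat T (j + 1))) (x (Fin.ofNat T (j + 2)))

/-- The law with `k` pair factors and `m` triple factors. -/
noncomputable def hybrid (μ : Measure 𝒳) (L : 𝒳 → 𝒳 → NNReal) (V : 𝒳 → 𝒳 → 𝒳 → NNReal)
    (T : ℕ) [NeZero T] (k m : ℕ) : Measure (Fin T → 𝒳) :=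
  (baseline μ T).withDensity fun x => (pairProd L k x * tripleProd V m x : NNReal)

/-- Indices are natural numbers sent to `Fin T` by `Fin.ofNat`, which reduces modulo `T`, so that
products and inductions run over `ℕ`. The bounds exclude wraparound. -/
lemma ofNat_ne {i j : ℕ} (hi : i < T) (hj : j < T) (hij : i ≠ j) :
    Fin.ofNat T i ≠ Fin.ofNat T j := by
  intro h
  have := congrArg Fin.val h
  simp only [Fin.val_ofNat, Nat.mod_eq_of_lt hi, Nat.mod_eq_of_lt hj] at this
  exact hij this

lemma dependsOn_update {α β : Type*} {n : ℕ} {G : (Fin T → α) → β}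
    (hG : DependsOn G {i : Fin T | (i : ℕ) < n}) {j : ℕ} (hj : j < T) (hnj : n ≤ j)
    (x : Fin T → α) (z : α) : G (Function.update x (Fin.ofNat T j) z) = G x := by
  refine hG fun i hi => Function.update_of_ne ?_ _ _
  rintro rfl
  simp only [Set.mem_ofPred_eq, Fin.val_ofNat, Nat.mod_eq_of_lt hj] at hi
  omega

lemma ofNat_lt {i n : ℕ} (hi : i < n) : ((Fin.ofNat T i : Fin T) : ℕ) < n :=
  (Nat.mod_le _ _).trans_lt hi

lemma pairProd_dependsOn {α : Type*} (L : α → α → NNReal) (k : ℕ) :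
    DependsOn (pairProd (T := T) L k) {i : Fin T | (i : ℕ) < k + 1} := by
  intro x y h
  refine Finset.prod_congr rfl fun i hi => ?_
  have := Finset.mem_range.1 hi
  rw [h _ (ofNat_lt (by omega)), h _ (ofNat_lt (by omega))]

lemma tripleProd_dependsOn {α : Type*} (V : α → α → α → NNReal) (m : ℕ) :
    DependsOn (tripleProd (T := T) V m) {i : Fin T | (i : ℕ) < m + 2} := by
  intro x y h
  refine Finset.prod_congr rfl fun i hi => ?_
  have := Finset.mem_range.1 hi
  rw [h _ (ofNat_lt (by omega)), h _ (ofNat_lt (by omega)), h _ (ofNat_lt (by omega))]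

variable {μ : Measure 𝒳} {L : 𝒳 → 𝒳 → NNReal} {V : 𝒳 → 𝒳 → 𝒳 → NNReal}

lemma IsTransition.measurable_pair (hLV : IsTransition μ L V) {n : ℕ} (i j : Fin n) :
    Measurable fun x : Fin n → 𝒳 => L (x i) (x j) :=
  hLV.measL.comp (f := fun x : Fin n → 𝒳 => (x i, x j)) (by fun_prop)

lemma IsTransition.measurable_triple (hLV : IsTransition μ L V) {n : ℕ} (i j k : Fin n) :
    Measurable fun x : Fin n → 𝒳 => V (x i) (x j) (x k) :=
  hLV.measV.comp (f := fun x : Fin n → 𝒳 => (x i, x j, x k)) (by fun_prop)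

lemma IsTransition.measurable_pairProd (hLV : IsTransition μ L V) (k : ℕ) :
    Measurable (pairProd (T := T) L k) :=
  Finset.measurable_prod _ fun _ _ => hLV.measurable_pair _ _

lemma IsTransition.measurable_tripleProd (hLV : IsTransition μ L V) (m : ℕ) :
    Measurable (tripleProd (T := T) V m) :=
  Finset.measurable_prod _ fun _ _ => hLV.measurable_triple _ _ _

lemma lintegral_hybrid (hLV : IsTransition μ L V) (k m : ℕ) {G : (Fin T → 𝒳) → ℝ≥0∞}
    (hG : Measurable G) :
    ∫⁻ x, G x ∂(hybrid μ L V T k m)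
      = ∫⁻ x, (G x * tripleProd V m x) * pairProd L k x ∂(baseline μ T) := by
  have h1 := hLV.measurable_pairProd (T := T) k
  have h2 := hLV.measurable_tripleProd (T := T) m
  rw [hybrid, lintegral_withDensity_eq_lintegral_mul _ (by fun_prop) hG]
  refine lintegral_congr fun x => ?_
  simp only [Pi.mul_apply, ENNReal.coe_mul]
  ring

lemma hybrid_zero_zero : hybrid μ L V T 0 0 = baseline μ T := by
  simp [hybrid, pairProd, tripleProd]

lemma hybrid_succ_pair (hLV : IsTransition μ L V) (k : ℕ) :
    hybrid μ L V T (k + 1) 0 = (hybrid μ L V T k 0).withDensity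
      fun x => (L (x (Fin.ofNat T k)) (x (Fin.ofNat T (k + 1))) : ℝ≥0∞) := by
  have h1 := hLV.measurable_pairProd (T := T) k
  have h2 := hLV.measurable_tripleProd (T := T) 0
  have h3 := hLV.measurable_pair (n := T) (Fin.ofNat T k) (Fin.ofNat T (k + 1))
  rw [hybrid, hybrid, ← withDensity_mul _ (by fun_prop) h3.coe_nnreal_ennreal]
  congr 1
  funext x
  simp [pairProd, tripleProd, Finset.prod_range_succ]

lemma hybrid_succ_triple (hLV : IsTransition μ L V) (k m : ℕ) :
    hybrid μ L V T k (m + 1) = (hybrid μ L V T k m).withDensity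
      fun x => (V (x (Fin.ofNat T m)) (x (Fin.ofNat T (m + 1))) (x (Fin.ofNat T (m + 2)))
        : ℝ≥0∞) := by
  have h1 := hLV.measurable_pairProd (T := T) k
  have h2 := hLV.measurable_tripleProd (T := T) m
  have h3 := hLV.measurable_triple (n := T) (Fin.ofNat T m) (Fin.ofNat T (m + 1))
    (Fin.ofNat T (m + 2))
  rw [hybrid, hybrid, ← withDensity_mul _ (by fun_prop) h3.coe_nnreal_ennreal]
  congr 1
  funext x
  simp [tripleProd, Finset.prod_range_succ, mul_assoc]

variable [IsProbabilityMeasure μ]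

/-- Integration from the future: the last coordinate occurs only in the last factor, which
integrates to one by `right`. -/
lemma lintegral_mul_pairProd_of_le (hLV : IsTransition μ L V) {n k : ℕ} (hnk : n ≤ k)
    (hkT : k < T) {G : (Fin T → 𝒳) → ℝ≥0∞} (hG : Measurable G)
    (hGn : DependsOn G {i : Fin T | (i : ℕ) < n + 1}) :
    ∫⁻ x, G x * pairProd L k x ∂(baseline μ T)
      = ∫⁻ x, G x * pairProd L n x ∂(baseline μ T) := by
  induction k, hnk using Nat.le_induction with
  | base => rfl
  | succ k hk ih =>
    rw [← ih (by omega)]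
    have h1 := hLV.measurable_pairProd (T := T) k
    have h3 := hLV.measurable_pair (n := T) (Fin.ofNat T k) (Fin.ofNat T (k + 1))
    have e : ∀ x : Fin T → 𝒳, G x * (pairProd L (k + 1) x : ℝ≥0∞)
        = (G x * pairProd L k x) * L (x (Fin.ofNat T k)) (x (Fin.ofNat T (k + 1))) := by
      intro x
      simp [pairProd, Finset.prod_range_succ, mul_assoc]
    simp_rw [e]
    refine lintegral_baseline_mul_eq μ (Fin.ofNat T (k + 1)) (by fun_prop)
      h3.coe_nnreal_ennreal ?_ ?_
    · intro x z
      rw [dependsOn_update hGn hkT (by omega),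
        dependsOn_update (pairProd_dependsOn L k) hkT le_rfl]
    · intro x
      simp only [Function.update_self,
        Function.update_of_ne (ofNat_ne (T := T) (i := k) (j := k + 1) (by omega) hkT (by omega))]
      exact hLV.right _

/-- Integration from the past: the earliest coordinate occurs only in the earliest remaining factor,
which integrates to one by `left`. This expresses invariance of `μ` under the chain. -/
lemma lintegral_mul_pairProd_left (hLV : IsTransition μ L V) {k : ℕ} (hkT : k < T)
    {G : (Fin T → 𝒳) → ℝ≥0∞} (hG : Measurable G)
    (hGk : ∀ j, j < k → ∀ x z, G (Function.update x (Fin.ofNat T j) z) = G x) :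
    ∫⁻ x, G x * pairProd L k x ∂(baseline μ T) = ∫⁻ x, G x ∂(baseline μ T) := by
  -- The induction descends from `a = k`, where the product is empty. Coordinate `a` occurs in
  -- factor `a` but in none of the factors from `a + 1` on.
  have main : ∀ a, a ≤ k → ∫⁻ x, G x * (∏ i ∈ Finset.Ico a k,
      L (x (Fin.ofNat T i)) (x (Fin.ofNat T (i + 1))) : NNReal) ∂(baseline μ T)
      = ∫⁻ x, G x ∂(baseline μ T) := by
    intro a hak
    induction hak using Nat.decreasingInduction with
    | self => simp
    | of_succ a ha ih =>
      rw [← ih]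
      have h1 : Measurable fun x : Fin T → 𝒳 => (∏ i ∈ Finset.Ico (a + 1) k,
        L (x (Fin.ofNat T i)) (x (Fin.ofNat T (i + 1))) : NNReal) :=
        Finset.measurable_prod _ fun _ _ => hLV.measurable_pair _ _
      have h3 := hLV.measurable_pair (n := T) (Fin.ofNat T a) (Fin.ofNat T (a + 1))
      have e : ∀ x : Fin T → 𝒳, G x * (∏ i ∈ Finset.Ico a k,
          L (x (Fin.ofNat T i)) (x (Fin.ofNat T (i + 1))) : NNReal)
          = (G x * (∏ i ∈ Finset.Ico (a + 1) k,
          L (x (Fin.ofNat T i)) (x (Fin.ofNat T (i + 1))) : NNReal))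
            * L (x (Fin.ofNat T a)) (x (Fin.ofNat T (a + 1))) := by
        intro x
        rw [Finset.prod_eq_prod_Ico_succ_bot ha]
        push_cast
        ring
      simp_rw [e]
      refine lintegral_baseline_mul_eq μ (Fin.ofNat T a)
        (hG.mul h1.coe_nnreal_ennreal) h3.coe_nnreal_ennreal ?_ ?_
      · intro x z
        rw [hGk a ha]
        congr 2
        refine Finset.prod_congr rfl fun i hi => ?_
        have := Finset.mem_Ico.1 hi
        rw [Function.update_of_ne (ofNat_ne (by omega) (by omega) (by omega)),
          Function.update_of_ne (ofNat_ne (by omega) (by omega) (by omega))]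
      · intro x
        simp only [Function.update_self, Function.update_of_ne
          (ofNat_ne (T := T) (i := a + 1) (j := a) (by omega) (by omega) (by omega))]
        exact hLV.left _
  have := main 0 (Nat.zero_le _)
  rw [← this]
  simp [pairProd]

/-- With `k` factors the chain reaches coordinate `k` with law `μ`, while coordinate `k + 1` is
still an independent draw. The next pair factor is thus measured in exactly the norm bounded by
`η₁`. -/
lemma pairLaw_hybrid (hLV : IsTransition μ L V) {k : ℕ} (hk : k + 1 < T) :
    pairLaw (hybrid μ L V T k 0) (Fin.ofNat T k) (Fin.ofNat T (k + 1)) = μ.prod μ := by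
  have hm : Measurable fun x : Fin T → 𝒳 => (x (Fin.ofNat T k), x (Fin.ofNat T (k + 1))) := by
    fun_prop
  refine Measure.ext_of_lintegral _ fun φ hφ => ?_
  rw [pairLaw, lintegral_map hφ hm, lintegral_hybrid hLV k 0
    (G := fun x => φ (x (Fin.ofNat T k), x (Fin.ofNat T (k + 1)))) (hφ.comp hm)]
  simp only [tripleProd, Finset.range_zero, Finset.prod_empty, ENNReal.coe_one, mul_one]
  rw [lintegral_mul_pairProd_left hLV
    (G := fun x => φ (x (Fin.ofNat T k), x (Fin.ofNat T (k + 1)))) (by omega) (hφ.comp hm), ← lintegral_map hφ hm]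
  · rw [← map_eval_pair_baseline μ (ofNat_ne (T := T) (i := k) (j := k + 1) (by omega) hk
      (by omega)), pairLaw]
  · intro j hj x z
    rw [Function.update_of_ne (ofNat_ne (by omega) (by omega) (by omega)),
      Function.update_of_ne (ofNat_ne (by omega) (by omega) (by omega))]

end Chain

/-! ### Transitions of chains of order one and two -/

section MarkovLaws

variable {𝒳 : Type*} [MeasurableSpace 𝒳] {T : ℕ}

lemma measurableSet_cylinderEvents_forall {Δ Δ' : Set (Fin T)} (hΔ : Δ' ⊆ Δ)
    {C : Fin T → Set 𝒳} (hC : ∀ i, MeasurableSet (C i)) :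
    MeasurableSet[cylinderEvents (X := fun _ : Fin T => 𝒳) Δ] {x | ∀ i ∈ Δ', x i ∈ C i} := by
  have : {x : Fin T → 𝒳 | ∀ i ∈ Δ', x i ∈ C i} = ⋂ i ∈ Δ', (fun x => x i) ⁻¹' C i := by
    ext; simp
  rw [this]
  refine MeasurableSet.biInter Δ'.to_countable fun i hi => ?_
  exact measurable_cylinderEvent_apply (hΔ hi) (hC i)

lemma cylinderEvents_le_comap {E : Type*} [mE : MeasurableSpace E] {Δ : Set (Fin T)}
    {π : (Fin T → 𝒳) → E}
    (hπ : ∀ i ∈ Δ, ∃ g : E → 𝒳, Measurable g ∧ ∀ x, x i = g (π x)) :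
    cylinderEvents (X := fun _ : Fin T => 𝒳) Δ ≤ mE.comap π := by
  refine iSup₂_le fun i hi => ?_
  obtain ⟨g, hg, hgx⟩ := hπ i hi
  rintro _ ⟨s, hs, rfl⟩
  refine ⟨g ⁻¹' s, hg hs, ?_⟩
  ext x
  simp [hgx x]

variable {μ : Measure 𝒳} [IsProbabilityMeasure μ] {L : 𝒳 → 𝒳 → NNReal}
  {V : 𝒳 → 𝒳 → 𝒳 → NNReal}

lemma IsTransition.lintegral_triple (hLV : IsTransition μ L V) {K φ : 𝒳 × 𝒳 × 𝒳 → ℝ≥0∞}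
    (hK : Measurable K) (hφ : Measurable φ) :
    ∫⁻ p, φ p ∂((μ.prod (μ.prod μ)).withDensity fun p => (L p.1 p.2.1 : ℝ≥0∞) * K p)
      = ∫⁻ q, (∫⁻ z, φ (q.1, q.2, z) * K (q.1, q.2, z) ∂μ)
          ∂((μ.prod μ).withDensity fun q => (L q.1 q.2 : ℝ≥0∞)) := by
  have hL := hLV.measL
  have hL' : Measurable fun p : 𝒳 × 𝒳 × 𝒳 => L p.1 p.2.1 :=
    hL.comp (f := fun p : 𝒳 × 𝒳 × 𝒳 => (p.1, p.2.1)) (by fun_prop)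
  have hφK : Measurable fun p : (𝒳 × 𝒳) × 𝒳 => φ (p.1.1, p.1.2, p.2) * K (p.1.1, p.1.2, p.2) :=
    (hφ.mul hK).comp (f := fun p : (𝒳 × 𝒳) × 𝒳 => (p.1.1, p.1.2, p.2)) (by fun_prop)
  have hin : Measurable fun q : 𝒳 × 𝒳 => ∫⁻ z, φ (q.1, q.2, z) * K (q.1, q.2, z) ∂μ :=
    hφK.lintegral_prod_right'
  rw [lintegral_withDensity_eq_lintegral_mul _ (by fun_prop) hφ,
    lintegral_withDensity_eq_lintegral_mul _ (by fun_prop) hin,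
    lintegral_prod _ (by fun_prop), lintegral_prod _ (by fun_prop)]
  refine lintegral_congr fun x => ?_
  rw [lintegral_prod _ (by
    exact Measurable.aemeasurable ((hL'.coe_nnreal_ennreal.mul hK).mul hφ |>.comp
      measurable_prodMk_left))]
  refine lintegral_congr fun y => ?_
  simp only [Pi.mul_apply]
  rw [← lintegral_const_mul (L x y : ℝ≥0∞) (f := fun z => φ (x, y, z) * K (x, y, z))
    (hφK.comp (f := fun z => ((x, y), z)) (by fun_prop))]
  refine lintegral_congr fun z => ?_
  ring

lemma IsTransition.lintegral_fst (hLV : IsTransition μ L V) {φ : 𝒳 → ℝ≥0∞}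
    (hφ : Measurable φ) :
    ∫⁻ p, φ p.1 ∂((μ.prod μ).withDensity fun p => (L p.1 p.2 : ℝ≥0∞)) = ∫⁻ x, φ x ∂μ := by
  have hL := hLV.measL
  rw [lintegral_withDensity_eq_lintegral_mul _ (by fun_prop) (by fun_prop),
    lintegral_prod _ (by fun_prop)]
  refine lintegral_congr fun x => ?_
  simp only [Pi.mul_apply]
  rw [lintegral_mul_const (φ x) (f := fun z => (L x z : ℝ≥0∞))
    (hL.coe_nnreal_ennreal.comp measurable_prodMk_left)]
  rw [hLV.right, one_mul]

variable [NeZero T]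

/-- Three consecutive states of a Markov chain. -/
lemma IsTransition.tripleLaw_of_isDependent_one (hLV : IsTransition μ L V)
    {Q : Measure (Fin T → 𝒳)} [IsProbabilityMeasure Q] (hQ : IsDependent 1 Q) {n : ℕ}
    (hn : n + 2 < T)
    (h₁ : pairLaw Q (Fin.ofNat T n) (Fin.ofNat T (n + 1))
      = (μ.prod μ).withDensity fun p => (L p.1 p.2 : ℝ≥0∞))
    (h₂ : pairLaw Q (Fin.ofNat T (n + 1)) (Fin.ofNat T (n + 2))
      = (μ.prod μ).withDensity fun p => (L p.1 p.2 : ℝ≥0∞)) :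
    tripleLaw Q (Fin.ofNat T n) (Fin.ofNat T (n + 1)) (Fin.ofNat T (n + 2))
      = (μ.prod (μ.prod μ)).withDensity
        fun p => (L p.1 p.2.1 : ℝ≥0∞) * (L p.2.1 p.2.2 : ℝ≥0∞) := by
  have hL := hLV.measL
  have hm3 : Measurable fun x : Fin T → 𝒳 =>
    (x (Fin.ofNat T n), x (Fin.ofNat T (n + 1)), x (Fin.ofNat T (n + 2))) := by fun_prop
  have hm12 : Measurable fun x : Fin T → 𝒳 =>
    (x (Fin.ofNat T n), x (Fin.ofNat T (n + 1))) := by fun_prop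
  have hm23 : Measurable fun x : Fin T → 𝒳 =>
    (x (Fin.ofNat T (n + 1)), x (Fin.ofNat T (n + 2))) := by fun_prop
  have v0 : ((Fin.ofNat T n : Fin T) : ℕ) = n := Nat.mod_eq_of_lt (by omega)
  have v1 : ((Fin.ofNat T (n + 1) : Fin T) : ℕ) = n + 1 := Nat.mod_eq_of_lt (by omega)
  have v2 : ((Fin.ofNat T (n + 2) : Fin T) : ℕ) = n + 2 := Nat.mod_eq_of_lt hn
  have : IsFiniteMeasure (tripleLaw Q (Fin.ofNat T n) (Fin.ofNat T (n + 1))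
    (Fin.ofNat T (n + 2))) := by unfold tripleLaw; infer_instance
  refine Measure.ext_prod₃ fun {A D C} hA hD hC => ?_
  have hLyz : Measurable fun p : 𝒳 × 𝒳 × 𝒳 => (L p.2.1 p.2.2 : ℝ≥0∞) :=
    hL.coe_nnreal_ennreal.comp (f := fun p : 𝒳 × 𝒳 × 𝒳 => p.2) (by fun_prop)
  have hw' : Measurable fun y => ∫⁻ z in C, (L y z : ℝ≥0∞) ∂μ :=
    Measurable.lintegral_prod_right' (f := fun p : 𝒳 × 𝒳 => (L p.1 p.2 : ℝ≥0∞))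
      hL.coe_nnreal_ennreal
  -- For order one, taking `t = n + 1` makes coordinate `n + 1` the whole present; `w` is the
  -- probability of moving from it into `C`.
  have key := (hQ (n + 1)).measure_inter_inter cylinderEvents_le_pi cylinderEvents_le_pi
    cylinderEvents_le_pi
    (A := (fun x => x (Fin.ofNat T n)) ⁻¹' A) (D := (fun x => x (Fin.ofNat T (n + 1))) ⁻¹' D)
    (B := (fun x => x (Fin.ofNat T (n + 2))) ⁻¹' C)
    (w := fun x => ∫⁻ z in C, (L (x (Fin.ofNat T (n + 1))) z : ℝ≥0∞) ∂μ)
    (measurable_cylinderEvent_apply (by rw [Set.mem_ofPred_eq]; omega) hA)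
    (measurable_cylinderEvent_apply (by rw [Set.mem_ofPred_eq]; omega) hC)
    (measurable_cylinderEvent_apply (by rw [Set.mem_ofPred_eq]; omega) hD)
    (hw'.comp (measurable_cylinderEvent_apply (X := fun _ : Fin T => 𝒳)
      (i := Fin.ofNat T (n + 1)) (by rw [Set.mem_ofPred_eq]; omega)))
    (by
      intro E hE
      have hle : cylinderEvents (X := fun _ : Fin T => 𝒳)
          {s | n + 1 ≤ (s : ℕ) ∧ (s : ℕ) < n + 1 + 1}
          ≤ MeasurableSpace.comap (fun x => x (Fin.ofNat T (n + 1))) inferInstance := by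
        refine cylinderEvents_le_comap fun i hi => ⟨id, measurable_id, fun x => ?_⟩
        have : i = Fin.ofNat T (n + 1) := Fin.ext (by rw [v1]; have := hi.1; have := hi.2; omega)
        rw [this, id]
      obtain ⟨D', hD', rfl⟩ := hle _ hE
      have e : (fun x : Fin T → 𝒳 => x (Fin.ofNat T (n + 1))) ⁻¹' D'
          ∩ (fun x => x (Fin.ofNat T (n + 2))) ⁻¹' C
          = (fun x : Fin T → 𝒳 => (x (Fin.ofNat T (n + 1)), x (Fin.ofNat T (n + 2)))) ⁻¹'
            (D' ×ˢ C) := rfl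
      rw [e, ← Measure.map_apply hm23 (hD'.prod hC)]
      rw [pairLaw] at h₂
      rw [h₂, withDensity_apply _ (hD'.prod hC), ← Measure.prod_restrict,
        lintegral_prod _ (by fun_prop), ← lintegral_indicator (hD'),
        ← lintegral_indicator (hD'.preimage (measurable_pi_apply _))]
      rw [← hLV.lintegral_fst (hw'.indicator hD'), ← h₂, lintegral_map _ hm23]
      · rfl
      · exact (hw'.indicator hD').comp measurable_fst)
  have e : (fun x : Fin T → 𝒳 =>
      (x (Fin.ofNat T n), x (Fin.ofNat T (n + 1)), x (Fin.ofNat T (n + 2)))) ⁻¹' (A ×ˢ D ×ˢ C)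
      = (fun x => x (Fin.ofNat T n)) ⁻¹' A ∩ (fun x => x (Fin.ofNat T (n + 1))) ⁻¹' D
        ∩ (fun x => x (Fin.ofNat T (n + 2))) ⁻¹' C := by
    ext x; simp [and_assoc]
  rw [tripleLaw, Measure.map_apply hm3 (hA.prod (hD.prod hC)), e, key,
    ← lintegral_indicator_one (hA.prod (hD.prod hC)),
    hLV.lintegral_triple hLyz (measurable_one.indicator (hA.prod (hD.prod hC))), ← h₁, pairLaw,
    lintegral_map _ hm12, ← lintegral_indicator]
  · refine lintegral_congr fun x => ?_
    by_cases hx : x (Fin.ofNat T n) ∈ A ∧ x (Fin.ofNat T (n + 1)) ∈ D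
    · rw [Set.indicator_of_mem (by exact hx), ← lintegral_indicator hC]
      refine lintegral_congr fun z => ?_
      by_cases hz : z ∈ C
      · rw [Set.indicator_of_mem hz, Set.indicator_of_mem (by exact ⟨hx.1, hx.2, hz⟩),
          Pi.one_apply, one_mul]
      · rw [Set.indicator_of_notMem hz, Set.indicator_of_notMem (by exact fun h => hz h.2.2),
          zero_mul]
    · rw [Set.indicator_of_notMem (by exact hx)]
      symm
      rw [← lintegral_zero (μ := μ)]
      refine lintegral_congr fun z => ?_
      rw [Set.indicator_of_notMem, zero_mul]
      rintro ⟨h1, h2, -⟩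
      exact hx ⟨h1, h2⟩
  · exact (hA.preimage (measurable_pi_apply _)).inter (hD.preimage (measurable_pi_apply _))
  · exact Measurable.lintegral_prod_right' (f := fun p : (𝒳 × 𝒳) × 𝒳 =>
      ((A ×ˢ D ×ˢ C).indicator 1 (p.1.1, p.1.2, p.2) : ℝ≥0∞) * (L p.1.2 p.2 : ℝ≥0∞))
      (((measurable_one.indicator (hA.prod (hD.prod hC))).mul hLyz).comp
        (f := fun p : (𝒳 × 𝒳) × 𝒳 => (p.1.1, p.1.2, p.2)) (by fun_prop))

/-- One transition of a chain of order two, integrated against functions of the past. -/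
lemma IsTransition.lintegral_of_isDependent_two (hLV : IsTransition μ L V)
    {P : Measure (Fin T → 𝒳)} [IsProbabilityMeasure P] (hP : IsDependent 2 P) {n : ℕ}
    (hn : n + 2 < T)
    (h₁ : pairLaw P (Fin.ofNat T n) (Fin.ofNat T (n + 1))
      = (μ.prod μ).withDensity fun p => (L p.1 p.2 : ℝ≥0∞))
    (h₂ : tripleLaw P (Fin.ofNat T n) (Fin.ofNat T (n + 1)) (Fin.ofNat T (n + 2))
      = (μ.prod (μ.prod μ)).withDensity fun p => (L p.1 p.2.1 : ℝ≥0∞)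
        * ((L p.2.1 p.2.2 : ℝ≥0∞) * (V p.1 p.2.1 p.2.2 : ℝ≥0∞)))
    {G : (Fin T → 𝒳) → ℝ≥0∞} (hG : Measurable G)
    (hGn : DependsOn G {i : Fin T | (i : ℕ) < n + 3}) :
    ∫⁻ x, G x ∂P = ∫⁻ x, (∫⁻ z, G (Function.update x (Fin.ofNat T (n + 2)) z)
      * ((L (x (Fin.ofNat T (n + 1))) z : ℝ≥0∞)
        * (V (x (Fin.ofNat T n)) (x (Fin.ofNat T (n + 1))) z : ℝ≥0∞)) ∂μ) ∂P := by
  have hL := hLV.measL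
  have hV := hLV.measV
  have hm3 : Measurable fun x : Fin T → 𝒳 =>
    (x (Fin.ofNat T n), x (Fin.ofNat T (n + 1)), x (Fin.ofNat T (n + 2))) := by fun_prop
  have hm12 : Measurable fun x : Fin T → 𝒳 =>
    (x (Fin.ofNat T n), x (Fin.ofNat T (n + 1))) := by fun_prop
  have v0 : ((Fin.ofNat T n : Fin T) : ℕ) = n := Nat.mod_eq_of_lt (by omega)
  have v1 : ((Fin.ofNat T (n + 1) : Fin T) : ℕ) = n + 1 := Nat.mod_eq_of_lt (by omega)
  have v2 : ((Fin.ofNat T (n + 2) : Fin T) : ℕ) = n + 2 := Nat.mod_eq_of_lt hn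
  have hK : Measurable fun p : 𝒳 × 𝒳 × 𝒳 =>
      (L p.2.1 p.2.2 : ℝ≥0∞) * (V p.1 p.2.1 p.2.2 : ℝ≥0∞) :=
    (hL.coe_nnreal_ennreal.comp (f := fun p : 𝒳 × 𝒳 × 𝒳 => p.2) (by fun_prop)).mul
      hV.coe_nnreal_ennreal
  have hK' : Measurable fun p : (𝒳 × 𝒳) × 𝒳 =>
      (L p.1.2 p.2 : ℝ≥0∞) * (V p.1.1 p.1.2 p.2 : ℝ≥0∞) :=
    hK.comp (f := fun p : (𝒳 × 𝒳) × 𝒳 => (p.1.1, p.1.2, p.2)) (by fun_prop)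
  obtain ⟨a⟩ : Nonempty 𝒳 := μ.nonempty_of_neZero
  -- Freezing the coordinates from `n + 3` on at an arbitrary point leaves `G` unchanged and
  -- compares laws of the first `n + 3` coordinates without changing the space.
  set tr : (Fin T → 𝒳) → (Fin T → 𝒳) := fun x i => if (i : ℕ) < n + 3 then x i else a with htr
  have htrm : Measurable tr := by
    refine measurable_pi_iff.2 fun i => ?_
    by_cases hi : (i : ℕ) < n + 3
    · simp only [htr, hi, if_true]; fun_prop
    · simp only [htr, hi, if_false]; fun_prop
  have hGtr : ∀ x, G (tr x) = G x := fun x => hGn fun i hi => by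
    rw [Set.mem_ofPred_eq] at hi
    simp [htr, hi]
  set W : (Fin T → 𝒳) × 𝒳 → ℝ≥0∞ := fun p => (L (p.1 (Fin.ofNat T (n + 1))) p.2 : ℝ≥0∞)
        * (V (p.1 (Fin.ofNat T n)) (p.1 (Fin.ofNat T (n + 1))) p.2 : ℝ≥0∞) with hW
  have hWm : Measurable W := hK'.comp (f := fun p : (Fin T → 𝒳) × 𝒳 =>
    ((p.1 (Fin.ofNat T n), p.1 (Fin.ofNat T (n + 1))), p.2)) (by fun_prop)
  have hup : Measurable fun p : (Fin T → 𝒳) × 𝒳 =>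
    Function.update p.1 (Fin.ofNat T (n + 2)) p.2 := measurable_update'
  -- `ρ` redraws coordinate `n + 2` from the order-two transition. The lemma amounts to equality of
  -- `P` and `ρ` after truncation; the field `two` gives `ρ` the mass one needed for the π-system
  -- argument.
  set ρ : Measure (Fin T → 𝒳) := ((P.prod μ).withDensity W).map
    (fun p => Function.update p.1 (Fin.ofNat T (n + 2)) p.2) with hρ
  have hρint : ∀ H : (Fin T → 𝒳) → ℝ≥0∞, Measurable H → ∫⁻ x, H x ∂ρ
      = ∫⁻ x, (∫⁻ z, H (Function.update x (Fin.ofNat T (n + 2)) z) * W (x, z) ∂μ) ∂P := by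
    intro H hH
    rw [hρ, lintegral_map hH hup, lintegral_withDensity_eq_lintegral_mul _ hWm
      (g := fun p => H (Function.update p.1 (Fin.ofNat T (n + 2)) p.2)) (hH.comp hup),
      lintegral_prod _ (Measurable.aemeasurable (by exact hWm.mul (hH.comp hup)))]
    refine lintegral_congr fun x => lintegral_congr fun z => ?_
    rw [Pi.mul_apply, mul_comm]
  have hρone : ρ Set.univ = 1 := by
    rw [← lintegral_one, hρint _ measurable_const]
    simp only [one_mul, hW]
    simp_rw [hLV.two]
    simp
  have hrect : P.map tr = ρ.map tr := by
    refine ext_of_generate_finite _ generateFrom_pi.symm isPiSystem_pi ?_ ?_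
    · rintro _ ⟨C, hC, rfl⟩
      have hC' : ∀ i, MeasurableSet (C i) := fun i => hC i (Set.mem_univ i)
      have hCm := MeasurableSet.univ_pi hC'
      rw [Measure.map_apply htrm hCm, Measure.map_apply htrm hCm]
      -- A box seen through `tr` splits into past, present `{n, n + 1}` and next coordinate. The
      -- frozen coordinates contribute a condition independent of `x`, stored in `A`.
      set A : Set (Fin T → 𝒳) := {x | (∀ i ∈ {i : Fin T | (i : ℕ) < n}, x i ∈ C i) ∧
        ∀ i : Fin T, n + 3 ≤ (i : ℕ) → a ∈ C i} with hA
      set D : Set (Fin T → 𝒳) :=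
        {x | ∀ i ∈ {i : Fin T | n ≤ (i : ℕ) ∧ (i : ℕ) < n + 2}, x i ∈ C i} with hD
      set B : Set (Fin T → 𝒳) := (fun x => x (Fin.ofNat T (n + 2))) ⁻¹'
        C (Fin.ofNat T (n + 2)) with hB
      have hABD : tr ⁻¹' (Set.univ.pi C) = A ∩ D ∩ B := by
        ext x
        simp only [Set.mem_preimage, Set.mem_pi, Set.mem_univ, true_implies, Set.mem_inter_iff,
          hA, hB, hD, htr, Set.mem_ofPred_eq]
        constructor
        · intro h
          refine ⟨⟨⟨fun i hi => ?_, fun i hi => ?_⟩, fun i hi => ?_⟩, ?_⟩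
          · simpa [show (i : ℕ) < n + 3 by omega] using h i
          · simpa [show ¬ (i : ℕ) < n + 3 by omega] using h i
          · simpa [show (i : ℕ) < n + 3 by omega] using h i
          · have := h (Fin.ofNat T (n + 2))
            rwa [if_pos (by omega)] at this
        · rintro ⟨⟨⟨h1, h2⟩, h3⟩, h4⟩ i
          split_ifs with hi
          · rcases lt_trichotomy (i : ℕ) (n + 2) with h | h | h
            · by_cases h' : (i : ℕ) < n
              · exact h1 i h'
              · exact h3 i ⟨by omega, h⟩
            · have : i = Fin.ofNat T (n + 2) := Fin.ext (by omega)
              rw [this]; exact h4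
            · omega
          · exact h2 i (by omega)
      have hAm : MeasurableSet[cylinderEvents (X := fun _ : Fin T => 𝒳)
          {s | (s : ℕ) < n}] A := by
        have := measurableSet_cylinderEvents_forall (T := T)
          (Set.Subset.refl {i : Fin T | (i : ℕ) < n}) hC'
        exact this.inter (MeasurableSet.const _)
      have hDm : MeasurableSet[cylinderEvents (X := fun _ : Fin T => 𝒳)
          {s | n ≤ (s : ℕ) ∧ (s : ℕ) < n + 2}] D :=
        measurableSet_cylinderEvents_forall (Set.Subset.refl _) hC'
      have hBm : MeasurableSet[cylinderEvents (X := fun _ : Fin T => 𝒳)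
          {s | n + 2 ≤ (s : ℕ)}] B :=
        measurable_cylinderEvent_apply (by rw [Set.mem_ofPred_eq]; omega) (hC' _)
      have hAm' := cylinderEvents_le_pi _ hAm
      have hDm' := cylinderEvents_le_pi _ hDm
      have hBm' := cylinderEvents_le_pi _ hBm
      set w' : 𝒳 × 𝒳 → ℝ≥0∞ := fun q => ∫⁻ z in C (Fin.ofNat T (n + 2)),
        (L q.2 z : ℝ≥0∞) * (V q.1 q.2 z : ℝ≥0∞) ∂μ with hw'
      have hw'm : Measurable w' := hK'.lintegral_prod_right'
      have hw'x : ∀ x : Fin T → 𝒳, w' (x (Fin.ofNat T n), x (Fin.ofNat T (n + 1)))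
          = ∫⁻ z, (C (Fin.ofNat T (n + 2))).indicator (fun z => W (x, z)) z ∂μ := fun x =>
        (lintegral_indicator (hC' _) _).symm
      have key := (hP n).measure_inter_inter cylinderEvents_le_pi cylinderEvents_le_pi
        cylinderEvents_le_pi hAm hBm hDm
        (w := fun x => w' (x (Fin.ofNat T n), x (Fin.ofNat T (n + 1))))
        (hw'm.comp (Measurable.prodMk
          (measurable_cylinderEvent_apply (X := fun _ : Fin T => 𝒳)
            (i := Fin.ofNat T n) (by rw [Set.mem_ofPred_eq]; omega))
          (measurable_cylinderEvent_apply (X := fun _ : Fin T => 𝒳)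
            (i := Fin.ofNat T (n + 1)) (by rw [Set.mem_ofPred_eq]; omega))))
        (by
          intro E hE
          have hle : cylinderEvents (X := fun _ : Fin T => 𝒳)
              {s | n ≤ (s : ℕ) ∧ (s : ℕ) < n + 2} ≤ MeasurableSpace.comap
                (fun x => (x (Fin.ofNat T n), x (Fin.ofNat T (n + 1)))) inferInstance := by
            refine cylinderEvents_le_comap fun i hi => ?_
            rw [Set.mem_ofPred_eq] at hi
            by_cases h : (i : ℕ) = n
            · refine ⟨Prod.fst, measurable_fst, fun x => ?_⟩
              rw [show i = Fin.ofNat T n from Fin.ext (by omega)]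
            · refine ⟨Prod.snd, measurable_snd, fun x => ?_⟩
              rw [show i = Fin.ofNat T (n + 1) from Fin.ext (by omega)]
          obtain ⟨D', hD', rfl⟩ := hle _ hE
          have hSm : MeasurableSet ((fun p : 𝒳 × 𝒳 × 𝒳 => (p.1, p.2.1)) ⁻¹' D'
              ∩ (fun p => p.2.2) ⁻¹' C (Fin.ofNat T (n + 2))) :=
            (hD'.preimage (by fun_prop)).inter ((hC' _).preimage (by fun_prop))
          have e : (fun x : Fin T → 𝒳 => (x (Fin.ofNat T n), x (Fin.ofNat T (n + 1)))) ⁻¹' D' ∩ B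
              = (fun x : Fin T → 𝒳 => (x (Fin.ofNat T n), x (Fin.ofNat T (n + 1)),
                x (Fin.ofNat T (n + 2)))) ⁻¹'
                ((fun p : 𝒳 × 𝒳 × 𝒳 => (p.1, p.2.1)) ⁻¹' D'
                ∩ (fun p => p.2.2) ⁻¹' C (Fin.ofNat T (n + 2))) := rfl
          have h₂' := h₂
          rw [tripleLaw] at h₂'
          rw [e, ← Measure.map_apply hm3 hSm, h₂', ← lintegral_indicator_one hSm,
            hLV.lintegral_triple hK (measurable_one.indicator hSm), ← h₁, pairLaw,
            lintegral_map _ hm12, ← lintegral_indicator (hD'.preimage hm12)]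
          · refine lintegral_congr fun x => ?_
            by_cases hx : (x (Fin.ofNat T n), x (Fin.ofNat T (n + 1))) ∈ D'
            · rw [Set.indicator_of_mem (by exact hx), hw'x]
              refine lintegral_congr fun z => ?_
              by_cases hz : z ∈ C (Fin.ofNat T (n + 2))
              · rw [Set.indicator_of_mem hz, Set.indicator_of_mem (by exact ⟨hx, hz⟩),
                  Pi.one_apply, one_mul]
              · rw [Set.indicator_of_notMem hz, Set.indicator_of_notMem (by exact fun h => hz h.2),
                  zero_mul]
            · rw [Set.indicator_of_notMem (by exact hx), ← lintegral_zero (μ := μ)]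
              refine lintegral_congr fun z => ?_
              rw [Set.indicator_of_notMem (by exact fun h => hx h.1), zero_mul]
          · exact Measurable.lintegral_prod_right' (f := fun p : (𝒳 × 𝒳) × 𝒳 =>
              (((fun p : 𝒳 × 𝒳 × 𝒳 => (p.1, p.2.1)) ⁻¹' D'
                ∩ (fun p => p.2.2) ⁻¹' C (Fin.ofNat T (n + 2))).indicator 1
                (p.1.1, p.1.2, p.2) : ℝ≥0∞) * ((L p.1.2 p.2 : ℝ≥0∞) * V p.1.1 p.1.2 p.2))
              (((measurable_one.indicator hSm).mul hK).comp
                (f := fun p : (𝒳 × 𝒳) × 𝒳 => (p.1.1, p.1.2, p.2)) (by fun_prop)))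
      rw [hABD, key, ← lintegral_indicator_one ((hAm'.inter hDm').inter hBm'),
        hρint _ (measurable_one.indicator ((hAm'.inter hDm').inter hBm')),
        ← lintegral_indicator (hAm'.inter hDm')]
      refine lintegral_congr fun x => ?_
      have hupd : ∀ i : Fin T, (i : ℕ) < n + 2 → ∀ z,
          Function.update x (Fin.ofNat T (n + 2)) z i = x i := fun i hi z =>
        Function.update_of_ne (by rintro rfl; omega) _ _
      have hmem : ∀ z, Function.update x (Fin.ofNat T (n + 2)) z ∈ A ∩ D ∩ B ↔
          x ∈ A ∩ D ∧ z ∈ C (Fin.ofNat T (n + 2)) := by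
        intro z
        simp only [Set.mem_inter_iff, hA, hD, hB, Set.mem_ofPred_eq, Set.mem_preimage,
          Function.update_self]
        refine and_congr (and_congr (and_congr ?_ Iff.rfl) ?_) Iff.rfl
        · exact forall₂_congr fun i hi => by rw [hupd i (by omega)]
        · exact forall₂_congr fun i hi => by rw [hupd i (by omega)]
      by_cases hx : x ∈ A ∩ D
      · rw [Set.indicator_of_mem hx, hw'x]
        refine lintegral_congr fun z => ?_
        by_cases hz : z ∈ C (Fin.ofNat T (n + 2))
        · rw [Set.indicator_of_mem hz, Set.indicator_of_mem ((hmem z).2 ⟨hx, hz⟩),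
            Pi.one_apply, one_mul]
        · rw [Set.indicator_of_notMem hz, Set.indicator_of_notMem fun h => hz ((hmem z).1 h).2,
            zero_mul]
      · rw [Set.indicator_of_notMem hx, ← lintegral_zero (μ := μ)]
        refine lintegral_congr fun z => ?_
        rw [Set.indicator_of_notMem fun h => hx ((hmem z).1 h).1, zero_mul]
    · rw [Measure.map_apply htrm MeasurableSet.univ, Measure.map_apply htrm MeasurableSet.univ,
        Set.preimage_univ, hρone, measure_univ]
  calc ∫⁻ x, G x ∂P = ∫⁻ x, G x ∂(P.map tr) := by
        rw [lintegral_map hG htrm]; simp_rw [hGtr]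
    _ = ∫⁻ x, G x ∂ρ := by rw [hrect, lintegral_map hG htrm]; simp_rw [hGtr]
    _ = _ := hρint G hG

end MarkovLaws

/-! ### A chain of order two is the full hybrid law -/

section Agreement

variable {𝒳 : Type*} [MeasurableSpace 𝒳] {T : ℕ} [NeZero T] {μ : Measure 𝒳}
  [IsProbabilityMeasure μ] {L : 𝒳 → 𝒳 → NNReal} {V : 𝒳 → 𝒳 → 𝒳 → NNReal}
  {P : Measure (Fin T → 𝒳)}

/-- `P` is the law of a chain of order two with the given pair and triple densities. -/
structure IsChainLaw (μ : Measure 𝒳) (L : 𝒳 → 𝒳 → NNReal) (V : 𝒳 → 𝒳 → 𝒳 → NNReal)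
    (P : Measure (Fin T → 𝒳)) : Prop extends IsTransition μ L V where
  isDependent : IsDependent 2 P
  pairLaw_eq : ∀ n, n + 1 < T → pairLaw P (Fin.ofNat T n) (Fin.ofNat T (n + 1))
      = (μ.prod μ).withDensity fun p => (L p.1 p.2 : ℝ≥0∞)
  tripleLaw_eq : ∀ n, n + 2 < T →
    tripleLaw P (Fin.ofNat T n) (Fin.ofNat T (n + 1)) (Fin.ofNat T (n + 2))
      = (μ.prod (μ.prod μ)).withDensity fun p => (L p.1 p.2.1 : ℝ≥0∞)
        * ((L p.2.1 p.2.2 : ℝ≥0∞) * (V p.1 p.2.1 p.2.2 : ℝ≥0∞))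

/-- The coordinate after the last one governed by the triple factors evolves by `L`. -/
lemma lintegral_hybrid_extend (hP : IsChainLaw μ L V P) {m : ℕ} (hm : m + 2 < T)
    (ih : ∀ G : (Fin T → 𝒳) → ℝ≥0∞, Measurable G →
      DependsOn G {i : Fin T | (i : ℕ) < m + 2} →
      ∫⁻ x, G x ∂(hybrid μ L V T (T - 1) m) = ∫⁻ x, G x ∂P)
    {H : (Fin T → 𝒳) → ℝ≥0∞} (hH : Measurable H)
    (hHm : DependsOn H {i : Fin T | (i : ℕ) < m + 3}) :
    ∫⁻ x, H x ∂(hybrid μ L V T (T - 1) m)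
      = ∫⁻ x, (∫⁻ z, H (Function.update x (Fin.ofNat T (m + 2)) z)
        * (L (x (Fin.ofNat T (m + 1))) z : ℝ≥0∞) ∂μ) ∂P := by
  have hLV := hP.toIsTransition
  have hL := hLV.measL
  have h1 := fun k => hLV.measurable_pairProd (T := T) k
  have h2 := hLV.measurable_tripleProd (T := T) m
  have hup : Measurable fun p : (Fin T → 𝒳) × 𝒳 =>
    Function.update p.1 (Fin.ofNat T (m + 2)) p.2 := measurable_update'
  have hLx : Measurable fun p : (Fin T → 𝒳) × 𝒳 =>
      (L (p.1 (Fin.ofNat T (m + 1))) p.2 : ℝ≥0∞) :=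
    hL.coe_nnreal_ennreal.comp (f := fun p : (Fin T → 𝒳) × 𝒳 =>
      (p.1 (Fin.ofNat T (m + 1)), p.2)) (by fun_prop)
  have hHL : Measurable fun p : (Fin T → 𝒳) × 𝒳 =>
      H (Function.update p.1 (Fin.ofNat T (m + 2)) p.2)
        * (L (p.1 (Fin.ofNat T (m + 1))) p.2 : ℝ≥0∞) := (hH.comp hup).mul hLx
  have hG : Measurable fun x : Fin T → 𝒳 =>
      ∫⁻ z, H (Function.update x (Fin.ofNat T (m + 2)) z)
        * (L (x (Fin.ofNat T (m + 1))) z : ℝ≥0∞) ∂μ := hHL.lintegral_prod_right'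
  have hGm : DependsOn (fun x : Fin T → 𝒳 =>
      ∫⁻ z, H (Function.update x (Fin.ofNat T (m + 2)) z)
        * (L (x (Fin.ofNat T (m + 1))) z : ℝ≥0∞) ∂μ) {i : Fin T | (i : ℕ) < m + 2} := by
    intro x y hxy
    refine lintegral_congr fun z => ?_
    rw [hxy _ (ofNat_lt (by omega))]
    congr 1
    refine hHm fun i hi => ?_
    rw [Set.mem_ofPred_eq] at hi
    by_cases h : i = Fin.ofNat T (m + 2)
    · rw [h, Function.update_self, Function.update_self]
    · rw [Function.update_of_ne h, Function.update_of_ne h]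
      refine hxy i ?_
      have : (i : ℕ) ≠ m + 2 := fun h' => h (Fin.ext (by
        rw [h']; exact (Nat.mod_eq_of_lt hm).symm))
      rw [Set.mem_ofPred_eq]; omega
  have hprod : ∀ {n : ℕ} {G : (Fin T → 𝒳) → ℝ≥0∞}, m + 2 ≤ n →
      DependsOn G {i : Fin T | (i : ℕ) < n} →
      DependsOn (fun x => G x * (tripleProd V m x : ℝ≥0∞)) {i : Fin T | (i : ℕ) < n} := by
    intro n G hn hGn x y hxy
    simp only
    rw [hGn hxy, tripleProd_dependsOn V m fun i hi => hxy i (lt_of_lt_of_le hi hn)]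
  -- Superfluous pair factors integrate out, leaving `m + 2` of them for `H` and `m + 1` for its
  -- average over the next coordinate. The difference is the single factor `L` of the transition
  -- into `m + 2`.
  rw [← ih _ hG hGm, lintegral_hybrid hLV _ _ hH, lintegral_hybrid hLV _ _ hG,
    lintegral_mul_pairProd_of_le hLV (n := m + 2) (by omega) (by omega) (by fun_prop)
      (hprod (by omega) hHm),
    lintegral_mul_pairProd_of_le hLV (n := m + 1) (by omega) (by omega) (by fun_prop)
      (hprod le_rfl hGm),
    lintegral_baseline_update μ (Fin.ofNat T (m + 2)) (by fun_prop)]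
  refine lintegral_congr fun x => ?_
  have hne : Fin.ofNat T (m + 1) ≠ Fin.ofNat T (m + 2) := ofNat_ne (by omega) hm (by omega)
  have e : ∀ z, H (Function.update x (Fin.ofNat T (m + 2)) z)
      * (tripleProd V m (Function.update x (Fin.ofNat T (m + 2)) z) : ℝ≥0∞)
      * (pairProd L (m + 2) (Function.update x (Fin.ofNat T (m + 2)) z) : ℝ≥0∞)
      = (H (Function.update x (Fin.ofNat T (m + 2)) z)
        * (L (x (Fin.ofNat T (m + 1))) z : ℝ≥0∞))
        * ((tripleProd V m x : ℝ≥0∞) * (pairProd L (m + 1) x : ℝ≥0∞)) := by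
    intro z
    have e1 : pairProd L (m + 2) (Function.update x (Fin.ofNat T (m + 2)) z)
        = pairProd L (m + 1) x * L (x (Fin.ofNat T (m + 1))) z := by
      rw [← dependsOn_update (pairProd_dependsOn L (m + 1)) hm le_rfl x z]
      rw [pairProd, Finset.prod_range_succ, Function.update_self, Function.update_of_ne hne]
      rfl
    rw [dependsOn_update (tripleProd_dependsOn V m) hm le_rfl, e1, ENNReal.coe_mul]
    ring
  simp_rw [e]
  rw [lintegral_mul_const _ (f := fun z => H (Function.update x (Fin.ofNat T (m + 2)) z)
    * (L (x (Fin.ofNat T (m + 1))) z : ℝ≥0∞)) (hHL.comp measurable_prodMk_left)]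
  simp only [mul_assoc]

/-- With `m` triple factors, the hybrid law and `P` agree on the first `m + 2` coordinates.
Inserting the next `V` turns the `L`-step into coordinate `m + 2` into an `L * V`-step, which is the
transition of `P` by dependence of order two. -/
lemma lintegral_hybrid_eq (hP : IsChainLaw μ L V P) [IsProbabilityMeasure P] (hT : 2 < T)
    {m : ℕ} (hm : m + 2 ≤ T) {G : (Fin T → 𝒳) → ℝ≥0∞} (hG : Measurable G)
    (hGm : DependsOn G {i : Fin T | (i : ℕ) < m + 2}) :
    ∫⁻ x, G x ∂(hybrid μ L V T (T - 1) m) = ∫⁻ x, G x ∂P := by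
  have hLV := hP.toIsTransition
  have hL := hLV.measL
  induction m generalizing G with
  | zero =>
    rw [lintegral_hybrid hLV _ _ hG]
    simp only [tripleProd, Finset.range_zero, Finset.prod_empty, ENNReal.coe_one, mul_one]
    rw [lintegral_mul_pairProd_of_le hLV (n := 1) (by omega) (by omega) hG hGm]
    have hne : Fin.ofNat T 0 ≠ Fin.ofNat T 1 := ofNat_ne (by omega) (by omega) (by omega)
    -- `G` sees only the first two coordinates, so the filler value at all others is immaterial.
    set γ : 𝒳 × 𝒳 → (Fin T → 𝒳) := fun q i => if i = Fin.ofNat T 0 then q.1 else q.2 with hγ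
    have hγm : Measurable γ := by
      refine measurable_pi_iff.2 fun i => ?_
      by_cases hi : i = Fin.ofNat T 0
      · simp only [hγ, hi, if_true]; fun_prop
      · simp only [hγ, hi, if_false]; fun_prop
    have hGγ : ∀ x, G x = G (γ (x (Fin.ofNat T 0), x (Fin.ofNat T 1))) := fun x =>
      hGm fun i hi => by
        rw [Set.mem_ofPred_eq] at hi
        by_cases h : i = Fin.ofNat T 0
        · rw [hγ]
          simp only
          rw [if_pos h, h]
        · simp only [hγ, if_neg h]
          congr 1
          refine Fin.ext ?_
          have h0 : (i : ℕ) ≠ 0 := fun h' => h (Fin.ext (by rw [h']; simp))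
          rw [Fin.val_ofNat, Nat.mod_eq_of_lt (by omega)]; omega
    have hm12 : Measurable fun x : Fin T → 𝒳 => (x (Fin.ofNat T 0), x (Fin.ofNat T 1)) := by
      fun_prop
    have hpb := map_eval_pair_baseline μ hne
    rw [pairLaw] at hpb
    have hp : P.map (fun x => (x (Fin.ofNat T 0), x (Fin.ofNat T 1)))
        = (μ.prod μ).withDensity fun p => (L p.1 p.2 : ℝ≥0∞) := hP.pairLaw_eq 0 (by omega)
    calc ∫⁻ x, G x * (pairProd L 1 x : ℝ≥0∞) ∂(baseline μ T)
        = ∫⁻ x, (fun q : 𝒳 × 𝒳 => G (γ q) * (L q.1 q.2 : ℝ≥0∞))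
            (x (Fin.ofNat T 0), x (Fin.ofNat T 1)) ∂(baseline μ T) := by
          refine lintegral_congr fun x => ?_
          simp only
          rw [← hGγ x, pairProd, Finset.prod_range_one]
      _ = ∫⁻ q, G (γ q) * (L q.1 q.2 : ℝ≥0∞) ∂(μ.prod μ) := by
          rw [← hpb, lintegral_map (f := fun q => G (γ q) * (L q.1 q.2 : ℝ≥0∞))
            ((hG.comp hγm).mul hL.coe_nnreal_ennreal) hm12]
      _ = ∫⁻ q, G (γ q) ∂((μ.prod μ).withDensity fun p => (L p.1 p.2 : ℝ≥0∞)) := by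
          rw [lintegral_withDensity_eq_lintegral_mul _ (by fun_prop) (g := fun q => G (γ q))
            (hG.comp hγm)]
          refine lintegral_congr fun q => ?_
          rw [Pi.mul_apply, mul_comm]
      _ = ∫⁻ x, G x ∂P := by
          rw [← hp, lintegral_map (f := fun q => G (γ q)) (hG.comp hγm) hm12]
          exact lintegral_congr fun x => (hGγ x).symm
  | succ m ih =>
    have hVm := hLV.measurable_triple (Fin.ofNat T m) (Fin.ofNat T (m + 1)) (Fin.ofNat T (m + 2))
    have hdep : DependsOn (fun x : Fin T → 𝒳 => G x * (V (x (Fin.ofNat T m))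
        (x (Fin.ofNat T (m + 1))) (x (Fin.ofNat T (m + 2))) : ℝ≥0∞))
        {i : Fin T | (i : ℕ) < m + 3} := by
      intro x y hxy
      simp only
      rw [hGm hxy, hxy _ (ofNat_lt (by omega)), hxy _ (ofNat_lt (by omega)),
        hxy _ (ofNat_lt (by omega))]
    have e : ∫⁻ x, G x ∂(hybrid μ L V T (T - 1) (m + 1))
        = ∫⁻ x, G x * (V (x (Fin.ofNat T m)) (x (Fin.ofNat T (m + 1)))
          (x (Fin.ofNat T (m + 2))) : ℝ≥0∞) ∂(hybrid μ L V T (T - 1) m) := by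
      rw [hybrid_succ_triple hLV,
        lintegral_withDensity_eq_lintegral_mul _ hVm.coe_nnreal_ennreal hG]
      refine lintegral_congr fun x => ?_
      rw [Pi.mul_apply, mul_comm]
    rw [e, lintegral_hybrid_extend hP (by omega) (fun G hG hGm => ih (by omega) hG hGm)
      (H := fun x => G x * (V (x (Fin.ofNat T m)) (x (Fin.ofNat T (m + 1)))
        (x (Fin.ofNat T (m + 2))) : ℝ≥0∞)) (hG.mul hVm.coe_nnreal_ennreal) hdep,
      hLV.lintegral_of_isDependent_two hP.isDependent (n := m) (by omega)
        (hP.pairLaw_eq m (by omega)) (hP.tripleLaw_eq m (by omega)) hG hGm]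
    refine lintegral_congr fun x => lintegral_congr fun z => ?_
    rw [Function.update_self,
      Function.update_of_ne (ofNat_ne (i := m) (by omega) (by omega) (by omega)),
      Function.update_of_ne (ofNat_ne (i := m + 1) (by omega) (by omega) (by omega))]
    ring

lemma hybrid_full (hP : IsChainLaw μ L V P) [IsProbabilityMeasure P] (hT : 2 < T) :
    hybrid μ L V T (T - 1) (T - 2) = P :=
  Measure.ext_of_lintegral _ fun _ hG => lintegral_hybrid_eq hP hT (by omega) hG
    fun x y hxy => congrArg _ (funext fun i => hxy i (by
      have := i.2
      rw [Set.mem_ofPred_eq]; omega))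

/-- The first `m + 2` coordinates already have the law they have under `P`, and coordinate `m + 2`
still moves by `L` alone. Hence the next triple factor is measured in exactly the norm bounded by
`η₂`. -/
lemma tripleLaw_hybrid (hP : IsChainLaw μ L V P) [IsProbabilityMeasure P] (hT : 2 < T)
    {m : ℕ} (hm : m + 2 < T) :
    tripleLaw (hybrid μ L V T (T - 1) m) (Fin.ofNat T m) (Fin.ofNat T (m + 1))
      (Fin.ofNat T (m + 2)) = (μ.prod (μ.prod μ)).withDensity
        fun p => (L p.1 p.2.1 : ℝ≥0∞) * (L p.2.1 p.2.2 : ℝ≥0∞) := by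
  have hLV := hP.toIsTransition
  have hL := hLV.measL
  have hLyz : Measurable fun p : 𝒳 × 𝒳 × 𝒳 => (L p.2.1 p.2.2 : ℝ≥0∞) :=
    hL.coe_nnreal_ennreal.comp (f := fun p : 𝒳 × 𝒳 × 𝒳 => p.2) (by fun_prop)
  have hm3 : Measurable fun x : Fin T → 𝒳 =>
    (x (Fin.ofNat T m), x (Fin.ofNat T (m + 1)), x (Fin.ofNat T (m + 2))) := by fun_prop
  have hm12 : Measurable fun x : Fin T → 𝒳 =>
    (x (Fin.ofNat T m), x (Fin.ofNat T (m + 1))) := by fun_prop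
  refine Measure.ext_of_lintegral _ fun φ hφ => ?_
  have hp := hP.pairLaw_eq m (by omega)
  rw [pairLaw] at hp
  rw [tripleLaw, lintegral_map hφ hm3, lintegral_hybrid_extend hP hm
    (fun G hG hGm => lintegral_hybrid_eq hP hT (by omega) hG hGm)
    (H := fun x => φ (x (Fin.ofNat T m), x (Fin.ofNat T (m + 1)), x (Fin.ofNat T (m + 2))))
    (hφ.comp hm3), hLV.lintegral_triple hLyz hφ, ← hp, lintegral_map _ hm12]
  · refine lintegral_congr fun x => lintegral_congr fun z => ?_
    rw [Function.update_self,
      Function.update_of_ne (ofNat_ne (i := m) (by omega) (by omega) (by omega)),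
      Function.update_of_ne (ofNat_ne (i := m + 1) (by omega) (by omega) (by omega))]
  · exact Measurable.lintegral_prod_right' (f := fun p : (𝒳 × 𝒳) × 𝒳 =>
      φ (p.1.1, p.1.2, p.2) * (L p.1.2 p.2 : ℝ≥0∞)) ((hφ.mul hLyz).comp
        (f := fun p : (𝒳 × 𝒳) × 𝒳 => (p.1.1, p.1.2, p.2)) (by fun_prop))
  · intro x y hxy
    simp only
    rw [hxy _ (ofNat_lt (by omega)), hxy _ (ofNat_lt (by omega)), hxy _ (ofNat_lt (by omega))]

end Agreement

/-! ### Effect of one density factor on an expectation -/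

section Perturbation

variable {Ω E F : Type*} [MeasurableSpace Ω] [MeasurableSpace E] [MeasurableSpace F]

lemma abs_integral_withDensity_comp_sub_le {A : Measure Ω} [IsProbabilityMeasure A] {π : Ω → E}
    (hπ : Measurable π) {v : E → NNReal} (hv : Measurable v)
    (hvL : MemLp (fun e => (v e : ℝ) - 1) 2 (A.map π)) {η : ℝ}
    (hη : ∫ e, ((v e : ℝ) - 1) ^ 2 ∂(A.map π) ≤ η)
    {f : Ω → ℝ} (hf : Measurable f) {K : ℝ} (hK : ∀ x, |f x| ≤ K) :
    |∫ x, f x ∂(A.withDensity fun x => (v (π x) : ℝ≥0∞)) - ∫ x, f x ∂A| ≤ K * √η := by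
  have hm : Measurable fun e => (v e : ℝ) - 1 := by fun_prop
  refine (abs_integral_withDensity_sub_le (v := fun x => v (π x)) (by fun_prop)
    (hvL.comp_of_map hπ.aemeasurable) ?_ hf hK).2
  rwa [integral_map hπ.aemeasurable (by fun_prop)] at hη

/-- First-order effect on a bounded expectation of a perturbation of the law of `π`. -/
lemma abs_integral_withDensity_comp_sub_integral_le {A P₀ : Measure Ω} [IsProbabilityMeasure A]
    [IsProbabilityMeasure P₀] {π : Ω → E} (hπ : Measurable π) {v : E → NNReal} (hv : Measurable v)
    (hvL : MemLp (fun e => (v e : ℝ) - 1) 2 (A.map π)) {η : ℝ}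
    (hη : ∫ e, ((v e : ℝ) - 1) ^ 2 ∂(A.map π) ≤ η)
    {h : Ω → ℝ} (hh : Measurable h) {C : ℝ} (hC : ∀ x, |h x| ≤ C)
    {c : E → ℝ} (hc : Measurable c) (hcC : ∀ e, |c e| ≤ C)
    (hproj : ∀ φ : E → ℝ, Measurable φ → (∀ e, |φ e| ≤ 2 * C) →
      ∫ x, φ (π x) * (h x - c (π x)) ∂P₀ = 0)
    {δ : ℝ} (hδ : ∀ f : Ω → ℝ, Measurable f → ∀ K : ℝ, (∀ x, |f x| ≤ K) →
      |∫ x, f x ∂A - ∫ x, f x ∂P₀| ≤ K * δ) :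
    |∫ x, h x ∂(A.withDensity fun x => (v (π x) : ℝ≥0∞)) - ∫ x, h x ∂A
      - ∫ e, ((v e : ℝ) - 1) * c e ∂(A.map π)| ≤ √η * (2 * C * √δ) := by
  have hm : Measurable fun e => (v e : ℝ) - 1 := by fun_prop
  have hL := hvL.comp_of_map hπ.aemeasurable
  rw [integral_map hπ.aemeasurable (by fun_prop)] at hη
  rw [(abs_integral_withDensity_sub_le (v := fun x => v (π x)) (by fun_prop) hL hη hh hC).1,
    integral_map hπ.aemeasurable (by fun_prop), ← integral_sub]
  · have := abs_integral_mul_sub_condExp_le hπ hm hL hη hh hC hc hcC hproj hδ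
    simpa only [mul_sub] using this
  · exact hL.integrable_mul (MemLp.of_bound (p := 2) hh.aestronglyMeasurable C (ae_of_all _ hC))
  · exact hL.integrable_mul (MemLp.of_bound (p := 2) (hc.comp hπ).aestronglyMeasurable C
      (ae_of_all _ fun x => hcC (π x)))

/-- Reweighting by `v` does not change the law of `g`, so `v - 1` is orthogonal to functions of `g`.
This orthogonality produces the subtracted terms of `R` and `S`. -/
lemma integral_sub_one_mul_comp_eq_zero {A : Measure E} [IsProbabilityMeasure A] {v : E → NNReal}
    (hv : Measurable v) (hvL : MemLp (fun e => (v e : ℝ) - 1) 2 A) {g : E → F}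
    (hg : Measurable g) (hmap : (A.withDensity fun e => (v e : ℝ≥0∞)).map g = A.map g)
    {a : F → ℝ} (ha : Measurable a) {K : ℝ} (hK : ∀ y, |a y| ≤ K) :
    ∫ e, ((v e : ℝ) - 1) * a (g e) ∂A = 0 := by
  rw [← (abs_integral_withDensity_sub_le (f := fun e => a (g e)) hv hvL le_rfl (ha.comp hg)
    (fun x => hK (g x))).1]
  rw [← integral_map (f := a) hg.aemeasurable ha.aestronglyMeasurable,
    ← integral_map (f := a) hg.aemeasurable ha.aestronglyMeasurable, hmap, sub_self]

/-- Cauchy–Schwarz after subtracting from `c` a function `d` and a constant that are orthogonal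
to the perturbation. -/
lemma abs_integral_sub_one_mul_le {A : Measure E} [IsProbabilityMeasure A] {v : E → NNReal}
    (hvL : MemLp (fun e => (v e : ℝ) - 1) 2 A) {η : ℝ}
    (hη : ∫ e, ((v e : ℝ) - 1) ^ 2 ∂A ≤ η) {c d : E → ℝ} {K : ℝ}
    (hc : Measurable c) (hd : Measurable d) (hcK : ∀ e, |c e| ≤ K) (hdK : ∀ e, |d e| ≤ K)
    (h₀ : ∫ e, ((v e : ℝ) - 1) * d e ∂A = 0) :
    |∫ e, ((v e : ℝ) - 1) * c e ∂A| ≤ √η * √(∫ e, (c e - d e) ^ 2 ∂A) := by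
  have h1 := MemLp.of_bound (p := 2) (μ := A) hc.aestronglyMeasurable K (ae_of_all _ hcK)
  have h2 := MemLp.of_bound (p := 2) (μ := A) hd.aestronglyMeasurable K (ae_of_all _ hdK)
  have e : ∫ e, ((v e : ℝ) - 1) * c e ∂A = ∫ e, ((v e : ℝ) - 1) * (c e - d e) ∂A := by
    simp only [mul_sub]
    have i1 : Integrable (fun e => ((v e : ℝ) - 1) * c e) A := hvL.integrable_mul h1
    have i2 : Integrable (fun e => ((v e : ℝ) - 1) * d e) A := hvL.integrable_mul h2
    rw [integral_sub i1 i2, h₀, sub_zero]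
  rw [e]
  refine (abs_integral_mul_le_sqrt hvL (h1.sub h2)).trans ?_
  exact mul_le_mul_of_nonneg_right (Real.sqrt_le_sqrt hη) (Real.sqrt_nonneg _)

end Perturbation

/-! ### Conditional expectations under the i.i.d. law -/

section CondExpectations

variable {𝒳 : Type*} [MeasurableSpace 𝒳] (μ : Measure 𝒳) [IsProbabilityMeasure μ] {T : ℕ}
  {h : (Fin T → 𝒳) → ℝ} {C : ℝ}

lemma abs_E0_le (hC : ∀ x, |h x| ≤ C) : |E0 μ h| ≤ C := by
  have := norm_integral_le_of_norm_le_const (μ := baseline μ T) (f := h) (ae_of_all _ hC)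
  simpa [E0] using this

lemma abs_condE1_le (hC : ∀ x, |h x| ≤ C) (i : Fin T) (x : 𝒳) : |condE1 μ h i x| ≤ C :=
  abs_E0_le μ fun _ => hC _

lemma abs_condE2_le (hC : ∀ x, |h x| ≤ C) (i j : Fin T) (x y : 𝒳) :
    |condE2 μ h i j x y| ≤ C :=
  abs_E0_le μ fun _ => hC _

lemma abs_condE3_le (hC : ∀ x, |h x| ≤ C) (i j k : Fin T) (x y z : 𝒳) :
    |condE3 μ h i j k x y z| ≤ C :=
  abs_E0_le μ fun _ => hC _

lemma measurable_condE1 (hh : Measurable h) (i : Fin T) : Measurable (condE1 μ h i) := by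
  have : Measurable fun p : (Fin T → 𝒳) × 𝒳 => h (Function.update p.1 i p.2) :=
    hh.comp measurable_update'
  exact this.stronglyMeasurable.integral_prod_left'.measurable

lemma measurable_condE2 (hh : Measurable h) (i j : Fin T) :
    Measurable fun p : 𝒳 × 𝒳 => condE2 μ h i j p.1 p.2 := by
  have : Measurable fun p : (Fin T → 𝒳) × (𝒳 × 𝒳) =>
      h (Function.update (Function.update p.1 i p.2.1) j p.2.2) :=
    hh.comp (measurePreserving_update₂ μ i j).measurable
  exact this.stronglyMeasurable.integral_prod_left'.measurable

lemma measurable_condE3 (hh : Measurable h) (i j k : Fin T) :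
    Measurable fun p : 𝒳 × 𝒳 × 𝒳 => condE3 μ h i j k p.1 p.2.1 p.2.2 := by
  have : Measurable fun p : (Fin T → 𝒳) × (𝒳 × 𝒳 × 𝒳) =>
      h (Function.update (Function.update (Function.update p.1 i p.2.1) j p.2.2.1) k p.2.2.2) :=
    hh.comp (measurePreserving_update₃ μ i j k).measurable
  exact this.stronglyMeasurable.integral_prod_left'.measurable

/-- If resampling the block `π` at the value `e` averages `h` to `c e`, then `c ∘ π` is the
projection of `h` on the functions of `π`. -/
lemma integral_mul_sub_eq_zero {Ω E : Type*} [MeasurableSpace Ω] [MeasurableSpace E]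
    {P₀ : Measure Ω} {ρ : Measure E} [IsProbabilityMeasure P₀] [IsProbabilityMeasure ρ]
    {U : Ω × E → Ω} (hU : MeasurePreserving U (P₀.prod ρ) P₀) {π : Ω → E} (hπ : Measurable π)
    (hπU : ∀ p, π (U p) = p.2) {h : Ω → ℝ} (hh : Measurable h) {C : ℝ} (hC : ∀ x, |h x| ≤ C)
    {c : E → ℝ} (hc : Measurable c) (hcC : ∀ e, |c e| ≤ C)
    (hcU : ∀ e, c e = ∫ x, h (U (x, e)) ∂P₀) {φ : E → ℝ} (hφ : Measurable φ) {K : ℝ}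
    (hφK : ∀ e, |φ e| ≤ K) :
    ∫ x, φ (π x) * (h x - c (π x)) ∂P₀ = 0 := by
  have hUm := hU.measurable
  have hm : Measurable fun x => φ (π x) * (h x - c (π x)) := by fun_prop
  have e1 : ∫ x, φ (π x) * (h x - c (π x)) ∂P₀
      = ∫ p, φ p.2 * (h (U p) - c p.2) ∂(P₀.prod ρ) := by
    conv_lhs => rw [← hU.map_eq]
    rw [integral_map hUm.aemeasurable hm.aestronglyMeasurable]
    simp_rw [hπU]
  have hm2 : Measurable fun p : Ω × E => φ p.2 * (h (U p) - c p.2) := by fun_prop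
  have hint : Integrable (fun p : Ω × E => φ p.2 * (h (U p) - c p.2)) (P₀.prod ρ) := by
    refine Integrable.of_bound hm2.aestronglyMeasurable (K * (2 * C)) (ae_of_all _ fun p => ?_)
    rw [Real.norm_eq_abs, abs_mul]
    refine mul_le_mul (hφK _) ?_ (abs_nonneg _) ((abs_nonneg _).trans (hφK p.2))
    calc |h (U p) - c p.2| ≤ |h (U p)| + |c p.2| := abs_sub _ _
      _ ≤ 2 * C := by linarith [hC (U p), hcC p.2]
  rw [e1, integral_prod_symm _ hint]
  rw [← integral_zero E ℝ (μ := ρ)]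
  refine integral_congr_ae (ae_of_all _ fun e => ?_)
  have hi : Integrable (fun x => h (U (x, e))) P₀ :=
    Integrable.of_bound (hh.comp (hUm.comp measurable_prodMk_right)).aestronglyMeasurable C
      (ae_of_all _ fun x => hC _)
  simp only
  rw [integral_const_mul, integral_sub hi (integrable_const _), ← hcU]
  simp

lemma integral_mul_sub_condE2 (hh : Measurable h) (hC : ∀ x, |h x| ≤ C) {i j : Fin T}
    (hij : i ≠ j) {φ : 𝒳 × 𝒳 → ℝ} (hφ : Measurable φ) {K : ℝ} (hφK : ∀ e, |φ e| ≤ K) :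
    ∫ x, φ (x i, x j) * (h x - condE2 μ h i j (x i) (x j)) ∂(baseline μ T) = 0 :=
  integral_mul_sub_eq_zero (measurePreserving_update₂ μ i j) (π := fun x => (x i, x j))
    (by fun_prop) (fun p => by simp [hij]) hh hC (measurable_condE2 μ hh i j)
    (fun _ => abs_condE2_le μ hC _ _ _ _) (fun _ => rfl) hφ hφK

lemma integral_mul_sub_condE3 (hh : Measurable h) (hC : ∀ x, |h x| ≤ C) {i j k : Fin T}
    (hij : i ≠ j) (hik : i ≠ k) (hjk : j ≠ k) {φ : 𝒳 × 𝒳 × 𝒳 → ℝ} (hφ : Measurable φ) {K : ℝ}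
    (hφK : ∀ e, |φ e| ≤ K) :
    ∫ x, φ (x i, x j, x k) * (h x - condE3 μ h i j k (x i) (x j) (x k)) ∂(baseline μ T) = 0 :=
  integral_mul_sub_eq_zero (measurePreserving_update₃ μ i j k) (π := fun x => (x i, x j, x k))
    (by fun_prop) (fun p => by simp [hij, hik, hjk]) hh hC (measurable_condE3 μ hh i j k)
    (fun _ => abs_condE3_le μ hC _ _ _ _ _ _) (fun _ => rfl) hφ hφK

end CondExpectations

/-! ### The Markov triple and the telescoping expansions -/

section ChainBound

variable {𝒳 : Type*} [MeasurableSpace 𝒳] {T : ℕ} [NeZero T] {μ : Measure 𝒳}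
  {L : 𝒳 → 𝒳 → NNReal} {V : 𝒳 → 𝒳 → 𝒳 → NNReal} {P : Measure (Fin T → 𝒳)}

lemma IsTransition.measurable_markov (hLV : IsTransition μ L V) :
    Measurable fun p : 𝒳 × 𝒳 × 𝒳 => (L p.2.1 p.2.2 : ℝ≥0∞) :=
  hLV.measL.coe_nnreal_ennreal.comp (f := fun p : 𝒳 × 𝒳 × 𝒳 => p.2) (by fun_prop)

lemma IsTransition.measurable_markov' (hLV : IsTransition μ L V) :
    Measurable fun p : 𝒳 × 𝒳 × 𝒳 => (L p.1 p.2.1 : ℝ≥0∞) :=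
  hLV.measL.coe_nnreal_ennreal.comp (f := fun p : 𝒳 × 𝒳 × 𝒳 => (p.1, p.2.1)) (by fun_prop)

/-- The law of three consecutive states of the Markov chain with transition density `L`. -/
noncomputable def markovTriple (μ : Measure 𝒳) (L : 𝒳 → 𝒳 → NNReal) : Measure (𝒳 × 𝒳 × 𝒳) :=
  (μ.prod (μ.prod μ)).withDensity fun p => (L p.1 p.2.1 : ℝ≥0∞) * (L p.2.1 p.2.2 : ℝ≥0∞)

lemma IsTransition.withDensity_markovTriple (hLV : IsTransition μ L V) :
    (markovTriple μ L).withDensity (fun p => (V p.1 p.2.1 p.2.2 : ℝ≥0∞))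
      = (μ.prod (μ.prod μ)).withDensity fun p => (L p.1 p.2.1 : ℝ≥0∞)
        * ((L p.2.1 p.2.2 : ℝ≥0∞) * (V p.1 p.2.1 p.2.2 : ℝ≥0∞)) := by
  have h1 := hLV.measurable_markov
  have h2 := hLV.measurable_markov'
  have h3 := hLV.measV
  rw [markovTriple, ← withDensity_mul _ (by fun_prop) (by fun_prop)]
  congr 1
  funext p
  simp [mul_assoc]

variable [IsProbabilityMeasure μ]

lemma IsTransition.lintegral_snd (hLV : IsTransition μ L V) {φ : 𝒳 → ℝ≥0∞}
    (hφ : Measurable φ) :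
    ∫⁻ p, φ p.2 ∂((μ.prod μ).withDensity fun p => (L p.1 p.2 : ℝ≥0∞)) = ∫⁻ x, φ x ∂μ := by
  have hL := hLV.measL
  rw [lintegral_withDensity_eq_lintegral_mul _ (by fun_prop) (by fun_prop),
    lintegral_prod_symm _ (by fun_prop)]
  refine lintegral_congr fun x => ?_
  simp only [Pi.mul_apply]
  rw [lintegral_mul_const (φ x) (f := fun z => (L z x : ℝ≥0∞))
    (hL.coe_nnreal_ennreal.comp measurable_prodMk_right), hLV.left, one_mul]

lemma IsTransition.map_fst (hLV : IsTransition μ L V) :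
    ((μ.prod μ).withDensity fun p => (L p.1 p.2 : ℝ≥0∞)).map Prod.fst = μ :=
  Measure.ext_of_lintegral _ fun φ hφ => by
    rw [lintegral_map hφ measurable_fst, hLV.lintegral_fst hφ]

lemma IsTransition.map_snd (hLV : IsTransition μ L V) :
    ((μ.prod μ).withDensity fun p => (L p.1 p.2 : ℝ≥0∞)).map Prod.snd = μ :=
  Measure.ext_of_lintegral _ fun φ hφ => by
    rw [lintegral_map hφ measurable_snd, hLV.lintegral_snd hφ]

lemma IsTransition.map_markovTriple_left (hLV : IsTransition μ L V) :
    (markovTriple μ L).map (fun p => (p.1, p.2.1))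
      = (μ.prod μ).withDensity fun p => (L p.1 p.2 : ℝ≥0∞) := by
  refine Measure.ext_of_lintegral _ fun φ hφ => ?_
  have hm : Measurable fun p : 𝒳 × 𝒳 × 𝒳 => φ (p.1, p.2.1) := by fun_prop
  rw [lintegral_map hφ (by fun_prop), markovTriple,
    hLV.lintegral_triple hLV.measurable_markov hm]
  refine lintegral_congr fun q => ?_
  simp only
  rw [lintegral_const_mul (φ (q.1, q.2)) (f := fun z => (L q.2 z : ℝ≥0∞))
    (hLV.measL.coe_nnreal_ennreal.comp measurable_prodMk_left), hLV.right, mul_one]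

/-- The first state is integrated out through `left`: invariance of `μ` makes the second pair
distributed like the first. -/
lemma IsTransition.map_markovTriple_right (hLV : IsTransition μ L V) :
    (markovTriple μ L).map (fun p => p.2)
      = (μ.prod μ).withDensity fun p => (L p.1 p.2 : ℝ≥0∞) := by
  have hL := hLV.measL
  refine Measure.ext_of_lintegral _ fun φ hφ => ?_
  have hm : Measurable fun p : 𝒳 × 𝒳 × 𝒳 => φ p.2 := by fun_prop
  have hin : Measurable fun y => ∫⁻ z, φ (y, z) * (L y z : ℝ≥0∞) ∂μ :=
    (hφ.mul hL.coe_nnreal_ennreal).lintegral_prod_right'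
  rw [lintegral_map hφ (by fun_prop), markovTriple,
    hLV.lintegral_triple hLV.measurable_markov hm]
  simp only
  rw [hLV.lintegral_snd hin, lintegral_withDensity_eq_lintegral_mul _ (by fun_prop) hφ,
    lintegral_prod _ (by fun_prop)]
  refine lintegral_congr fun y => lintegral_congr fun z => ?_
  rw [Pi.mul_apply, mul_comm]

lemma isProbabilityMeasure_hybrid_pair (hLV : IsTransition μ L V) {k : ℕ} (hk : k < T) :
    IsProbabilityMeasure (hybrid μ L V T k 0) := by
  constructor
  rw [← lintegral_one, lintegral_hybrid hLV _ _ measurable_const]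
  have := lintegral_mul_pairProd_left hLV (G := fun _ => 1) hk measurable_const
    (fun _ _ _ _ => rfl)
  simpa [tripleProd] using this

lemma isProbabilityMeasure_hybrid_triple (hP : IsChainLaw μ L V P) [IsProbabilityMeasure P]
    (hT : 2 < T) {m : ℕ} (hm : m + 2 ≤ T) :
    IsProbabilityMeasure (hybrid μ L V T (T - 1) m) := by
  constructor
  rw [← lintegral_one, lintegral_hybrid_eq hP hT hm measurable_const (fun _ _ _ => rfl)]
  simp

lemma IsTransition.isProbabilityMeasure_markovTriple (hLV : IsTransition μ L V) :
    IsProbabilityMeasure (markovTriple μ L) := by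
  have h : ((markovTriple μ L).map (fun p => (p.1, p.2.1))).map Prod.fst = μ := by
    rw [hLV.map_markovTriple_left, hLV.map_fst]
  constructor
  have := DFunLike.congr_fun h Set.univ
  rw [Measure.map_apply measurable_fst MeasurableSet.univ,
    Measure.map_apply (by fun_prop) (by simp)] at this
  simpa using this

variable {η₁ η₂ : ℝ}

/-- Crude closeness, one `√η₁` per factor. It supplies the `δ` of the first-order expansion and the
comparison of the second moments of `S`. -/
lemma abs_integral_hybrid_pair_sub_le (hLV : IsTransition μ L V)
    (hl : MemLp (fun p : 𝒳 × 𝒳 => (L p.1 p.2 : ℝ) - 1) 2 (μ.prod μ))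
    (hl₁ : ∫ p, ((L p.1 p.2 : ℝ) - 1) ^ 2 ∂(μ.prod μ) ≤ η₁)
    {f : (Fin T → 𝒳) → ℝ} (hf : Measurable f) {K : ℝ} (hK : ∀ x, |f x| ≤ K) {k : ℕ}
    (hk : k < T) :
    |∫ x, f x ∂(hybrid μ L V T k 0) - ∫ x, f x ∂(baseline μ T)| ≤ K * (k * √η₁) := by
  induction k with
  | zero => simp [hybrid_zero_zero]
  | succ k ih =>
    have := isProbabilityMeasure_hybrid_pair (T := T) hLV (k := k) (by omega)
    have hm := pairLaw_hybrid hLV hk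
    rw [pairLaw] at hm
    have h1 := abs_integral_withDensity_comp_sub_le (A := hybrid μ L V T k 0)
      (η := η₁)
      (π := fun x => (x (Fin.ofNat T k), x (Fin.ofNat T (k + 1)))) (by fun_prop) hLV.measL
      (by rw [hm]; exact hl) (by rw [hm]; exact hl₁) hf hK
    rw [hybrid_succ_pair hLV]
    refine (abs_sub_le _ (∫ x, f x ∂(hybrid μ L V T k 0)) _).trans ?_
    refine (add_le_add h1 (ih (by omega))).trans_eq ?_
    rw [Nat.cast_add_one]; ring

lemma abs_integral_hybrid_triple_sub_le (hP : IsChainLaw μ L V P) [IsProbabilityMeasure P]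
    (hT : 2 < T)
    (hl : MemLp (fun p : 𝒳 × 𝒳 => (L p.1 p.2 : ℝ) - 1) 2 (μ.prod μ))
    (hl₁ : ∫ p, ((L p.1 p.2 : ℝ) - 1) ^ 2 ∂(μ.prod μ) ≤ η₁)
    (hs : MemLp (fun p : 𝒳 × 𝒳 × 𝒳 => (V p.1 p.2.1 p.2.2 : ℝ) - 1) 2 (markovTriple μ L))
    (hs₂ : ∫ p, ((V p.1 p.2.1 p.2.2 : ℝ) - 1) ^ 2 ∂(markovTriple μ L) ≤ η₂)
    {f : (Fin T → 𝒳) → ℝ} (hf : Measurable f) {K : ℝ} (hK : ∀ x, |f x| ≤ K) {m : ℕ}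
    (hm : m + 2 ≤ T) :
    |∫ x, f x ∂(hybrid μ L V T (T - 1) m) - ∫ x, f x ∂(baseline μ T)|
      ≤ K * (((T - 1 : ℕ) : ℝ) * √η₁ + m * √η₂) := by
  have hLV := hP.toIsTransition
  induction m with
  | zero =>
    simpa using abs_integral_hybrid_pair_sub_le hLV hl hl₁ hf hK (k := T - 1) (by omega)
  | succ m ih =>
    have := isProbabilityMeasure_hybrid_triple hP hT (m := m) (by omega)
    have hmap := tripleLaw_hybrid hP hT (m := m) (by omega)
    rw [tripleLaw] at hmap
    have h1 := abs_integral_withDensity_comp_sub_le (A := hybrid μ L V T (T - 1) m)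
      (η := η₂)
      (π := fun x => (x (Fin.ofNat T m), x (Fin.ofNat T (m + 1)), x (Fin.ofNat T (m + 2))))
      (by fun_prop) hLV.measV (by rw [hmap]; exact hs) (by rw [hmap]; exact hs₂) hf hK
    rw [hybrid_succ_triple hLV]
    refine (abs_sub_le _ (∫ x, f x ∂(hybrid μ L V T (T - 1) m)) _).trans ?_
    refine (add_le_add h1 (ih (by omega))).trans_eq ?_
    rw [Nat.cast_add_one]; ring

/-- First-order expansion in the pair factors. -/
lemma abs_integral_hybrid_pair_expansion_le (hLV : IsTransition μ L V)
    (hl : MemLp (fun p : 𝒳 × 𝒳 => (L p.1 p.2 : ℝ) - 1) 2 (μ.prod μ))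
    (hl₁ : ∫ p, ((L p.1 p.2 : ℝ) - 1) ^ 2 ∂(μ.prod μ) ≤ η₁)
    {h : (Fin T → 𝒳) → ℝ} (hh : Measurable h) {C : ℝ} (hC : ∀ x, |h x| ≤ C) {k : ℕ}
    (hk : k < T) :
    |∫ x, h x ∂(hybrid μ L V T k 0) - E0 μ h
      - ∫ p, ((L p.1 p.2 : ℝ) - 1) * (∑ i ∈ Finset.range k,
        condE2 μ h (Fin.ofNat T i) (Fin.ofNat T (i + 1)) p.1 p.2) ∂(μ.prod μ)|
      ≤ k * (√η₁ * (2 * C * √(T * (√η₁ + √η₂)))) := by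
  induction k with
  | zero => simp [hybrid_zero_zero, E0]
  | succ k ih =>
    have := isProbabilityMeasure_hybrid_pair (T := T) hLV (k := k) (by omega)
    have hne : Fin.ofNat T k ≠ Fin.ofNat T (k + 1) := ofNat_ne (by omega) hk (by omega)
    have hm := pairLaw_hybrid hLV hk
    rw [pairLaw] at hm
    have h1 := abs_integral_withDensity_comp_sub_integral_le (A := hybrid μ L V T k 0)
      (η := η₁)
      (P₀ := baseline μ T)
      (π := fun x => (x (Fin.ofNat T k), x (Fin.ofNat T (k + 1)))) (by fun_prop) hLV.measL
      (by rw [hm]; exact hl) (by rw [hm]; exact hl₁) hh hC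
      (c := fun p => condE2 μ h (Fin.ofNat T k) (Fin.ofNat T (k + 1)) p.1 p.2)
      (measurable_condE2 μ hh _ _) (fun _ => abs_condE2_le μ hC _ _ _ _)
      (fun φ hφ hφK => integral_mul_sub_condE2 μ hh hC hne hφ hφK)
      -- A single `δ`, large enough for all hybrid laws, gives pair and triple steps remainders of
      -- the same form; this is why `η₂` appears here.
      (δ := T * (√η₁ + √η₂)) (fun f hf K hK => by
        have : Nonempty (Fin T → 𝒳) := (baseline μ T).nonempty_of_neZero
        refine (abs_integral_hybrid_pair_sub_le hLV hl hl₁ hf hK (by omega)).trans ?_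
        refine mul_le_mul_of_nonneg_left ?_ ((abs_nonneg _).trans (hK this.some))
        have : (k : ℝ) ≤ T := by exact_mod_cast (by omega : k ≤ T)
        exact mul_le_mul this (by linarith [Real.sqrt_nonneg η₂]) (Real.sqrt_nonneg _) (by positivity))
    rw [hm] at h1
    rw [hybrid_succ_pair hLV]
    have hi : ∀ s : Finset ℕ, Integrable (fun p : 𝒳 × 𝒳 => ((L p.1 p.2 : ℝ) - 1)
        * (∑ i ∈ s, condE2 μ h (Fin.ofNat T i) (Fin.ofNat T (i + 1)) p.1 p.2)) (μ.prod μ) := by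
      intro s
      refine hl.integrable_mul (MemLp.of_bound (p := 2) (Finset.measurable_fun_sum _ fun i _ =>
        measurable_condE2 μ hh _ _).aestronglyMeasurable (∑ i ∈ s, C) (ae_of_all _ fun p => ?_))
      exact (Finset.abs_sum_le_sum_abs _ _).trans
        (Finset.sum_le_sum fun i _ => abs_condE2_le μ hC _ _ _ _)
    have hi1 : Integrable (fun p : 𝒳 × 𝒳 => ((L p.1 p.2 : ℝ) - 1)
        * condE2 μ h (Fin.ofNat T k) (Fin.ofNat T (k + 1)) p.1 p.2) (μ.prod μ) := by
      simpa using hi {k}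
    simp only [Finset.sum_range_succ, mul_add (_ - (1 : ℝ))]
    rw [integral_add (hi _) hi1]
    have h2 := ih (by omega)
    simp only at h1
    have h3 := (abs_add_le _ _).trans (add_le_add h1 h2)
    refine (le_of_eq ?_).trans (h3.trans (le_of_eq ?_))
    · congr 1; abel
    · rw [add_comm, Nat.cast_add_one, add_mul, one_mul]

/-- First-order expansion in the triple factors. -/
lemma abs_integral_hybrid_triple_expansion_le (hP : IsChainLaw μ L V P) [IsProbabilityMeasure P]
    (hT : 2 < T)
    (hl : MemLp (fun p : 𝒳 × 𝒳 => (L p.1 p.2 : ℝ) - 1) 2 (μ.prod μ))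
    (hl₁ : ∫ p, ((L p.1 p.2 : ℝ) - 1) ^ 2 ∂(μ.prod μ) ≤ η₁)
    (hs : MemLp (fun p : 𝒳 × 𝒳 × 𝒳 => (V p.1 p.2.1 p.2.2 : ℝ) - 1) 2 (markovTriple μ L))
    (hs₂ : ∫ p, ((V p.1 p.2.1 p.2.2 : ℝ) - 1) ^ 2 ∂(markovTriple μ L) ≤ η₂)
    {h : (Fin T → 𝒳) → ℝ} (hh : Measurable h) {C : ℝ} (hC : ∀ x, |h x| ≤ C) {m : ℕ}
    (hm : m + 2 ≤ T) :
    |∫ x, h x ∂(hybrid μ L V T (T - 1) m) - ∫ x, h x ∂(hybrid μ L V T (T - 1) 0)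
      - ∫ p, ((V p.1 p.2.1 p.2.2 : ℝ) - 1) * (∑ i ∈ Finset.range m,
        condE3 μ h (Fin.ofNat T i) (Fin.ofNat T (i + 1)) (Fin.ofNat T (i + 2)) p.1 p.2.1 p.2.2)
        ∂(markovTriple μ L)|
      ≤ m * (√η₂ * (2 * C * √(T * (√η₁ + √η₂)))) := by
  have hLV := hP.toIsTransition
  induction m with
  | zero => simp
  | succ m ih =>
    have := isProbabilityMeasure_hybrid_triple hP hT (m := m) (by omega)
    have hmap := tripleLaw_hybrid hP hT (m := m) (by omega)
    rw [tripleLaw] at hmap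
    have h1 := abs_integral_withDensity_comp_sub_integral_le (A := hybrid μ L V T (T - 1) m)
      (η := η₂)
      (P₀ := baseline μ T)
      (π := fun x => (x (Fin.ofNat T m), x (Fin.ofNat T (m + 1)), x (Fin.ofNat T (m + 2))))
      (by fun_prop) hLV.measV
      (by rw [hmap]; exact hs) (by rw [hmap]; exact hs₂) hh hC
      (c := fun p => condE3 μ h (Fin.ofNat T m) (Fin.ofNat T (m + 1)) (Fin.ofNat T (m + 2))
        p.1 p.2.1 p.2.2)
      (measurable_condE3 μ hh _ _ _) (fun _ => abs_condE3_le μ hC _ _ _ _ _ _)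
      (fun φ hφ hφK => integral_mul_sub_condE3 μ hh hC (ofNat_ne (by omega) (by omega) (by omega))
        (ofNat_ne (by omega) (by omega) (by omega)) (ofNat_ne (by omega) (by omega) (by omega))
        hφ hφK)
      (δ := T * (√η₁ + √η₂)) (fun f hf K hK => by
        have : Nonempty (Fin T → 𝒳) := (baseline μ T).nonempty_of_neZero
        refine (abs_integral_hybrid_triple_sub_le hP hT hl hl₁ hs hs₂ hf hK (by omega)).trans ?_
        refine mul_le_mul_of_nonneg_left ?_ ((abs_nonneg _).trans (hK this.some))
        have e1 : ((T - 1 : ℕ) : ℝ) ≤ T := by exact_mod_cast (by omega : T - 1 ≤ T)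
        have e2 : (m : ℝ) ≤ T := by exact_mod_cast (by omega : m ≤ T)
        rw [mul_add]
        exact add_le_add (mul_le_mul_of_nonneg_right e1 (Real.sqrt_nonneg _))
          (mul_le_mul_of_nonneg_right e2 (Real.sqrt_nonneg _)))
    rw [hmap] at h1
    rw [hybrid_succ_triple hLV]
    have hi : ∀ s : Finset ℕ, Integrable (fun p : 𝒳 × 𝒳 × 𝒳 => ((V p.1 p.2.1 p.2.2 : ℝ) - 1)
        * (∑ i ∈ s, condE3 μ h (Fin.ofNat T i) (Fin.ofNat T (i + 1)) (Fin.ofNat T (i + 2))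
          p.1 p.2.1 p.2.2)) (markovTriple μ L) := by
      intro s
      have := hLV.isProbabilityMeasure_markovTriple
      refine hs.integrable_mul (MemLp.of_bound (p := 2) (Finset.measurable_fun_sum _ fun i _ =>
        measurable_condE3 μ hh _ _ _).aestronglyMeasurable (∑ i ∈ s, C) (ae_of_all _ fun p => ?_))
      exact (Finset.abs_sum_le_sum_abs _ _).trans
        (Finset.sum_le_sum fun i _ => abs_condE3_le μ hC _ _ _ _ _ _)
    have hi1 : Integrable (fun p : 𝒳 × 𝒳 × 𝒳 => ((V p.1 p.2.1 p.2.2 : ℝ) - 1)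
        * condE3 μ h (Fin.ofNat T m) (Fin.ofNat T (m + 1)) (Fin.ofNat T (m + 2))
          p.1 p.2.1 p.2.2) (markovTriple μ L) := by
      simpa using hi {m}
    simp only [Finset.sum_range_succ, mul_add (_ - (1 : ℝ))]
    rw [integral_add (hi _) hi1]
    have h2 := ih (by omega)
    simp only at h1
    have h3 := (abs_add_le _ _).trans (add_le_add h1 h2)
    refine (le_of_eq ?_).trans (h3.trans (le_of_eq ?_))
    · congr 1; rw [markovTriple]; abel
    · rw [add_comm, Nat.cast_add_one, add_mul, one_mul]

end ChainBound

/-! ### The interaction functions as sums -/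

section InteractionBounds

variable {𝒳 : Type*} [MeasurableSpace 𝒳] {T : ℕ} [NeZero T] {μ : Measure 𝒳}
  {h : (Fin T → 𝒳) → ℝ} {C : ℝ}

lemma ofNat_eq_mk {i : ℕ} (hi : i < T) : (⟨i, hi⟩ : Fin T) = Fin.ofNat T i :=
  Fin.ext (Nat.mod_eq_of_lt hi).symm

lemma R_eq_sum (x y : 𝒳) : R μ h x y
    = (∑ i ∈ Finset.range (T - 1), condE2 μ h (Fin.ofNat T i) (Fin.ofNat T (i + 1)) x y)
      - (∑ i ∈ Finset.range (T - 1), condE1 μ h (Fin.ofNat T i) x)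
      - (∑ i ∈ Finset.range (T - 1), condE1 μ h (Fin.ofNat T (i + 1)) y)
      + ((T : ℝ) - 1) * E0 μ h := by
  simp only [R, ofNat_eq_mk, Finset.sum_range]

lemma S_eq_sum (x y z : 𝒳) : S μ h x y z
    = (∑ i ∈ Finset.range (T - 2),
        condE3 μ h (Fin.ofNat T i) (Fin.ofNat T (i + 1)) (Fin.ofNat T (i + 2)) x y z)
      - (∑ i ∈ Finset.range (T - 2), condE2 μ h (Fin.ofNat T i) (Fin.ofNat T (i + 1)) x y)
      - (∑ i ∈ Finset.range (T - 2),
          condE2 μ h (Fin.ofNat T (i + 1)) (Fin.ofNat T (i + 2)) y z)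
      + (∑ i ∈ Finset.range (T - 2), condE1 μ h (Fin.ofNat T (i + 1)) y) := by
  simp only [S, ofNat_eq_mk, Finset.sum_range]

lemma abs_sum_range_le {n N : ℕ} (hn : n ≤ N) {C : ℝ} (hC0 : 0 ≤ C) {f : ℕ → ℝ} (hf : ∀ i, |f i| ≤ C) :
    |∑ i ∈ Finset.range n, f i| ≤ N * C := by
  refine (Finset.abs_sum_le_sum_abs _ _).trans ?_
  refine (Finset.sum_le_sum fun i _ => hf i).trans ?_
  rw [Finset.sum_const, Finset.card_range, nsmul_eq_mul]
  exact mul_le_mul_of_nonneg_right (by exact_mod_cast hn) hC0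

variable [IsProbabilityMeasure μ]

lemma measurable_R (hh : Measurable h) : Measurable fun p : 𝒳 × 𝒳 => R μ h p.1 p.2 := by
  simp only [R_eq_sum]
  refine (((Finset.measurable_fun_sum _ fun i _ => measurable_condE2 μ hh _ _).sub
    (Finset.measurable_fun_sum _ fun i _ => (measurable_condE1 μ hh _).comp measurable_fst)).sub
    (Finset.measurable_fun_sum _ fun i _ => (measurable_condE1 μ hh _).comp
      measurable_snd)).add measurable_const

lemma measurable_S (hh : Measurable h) :
    Measurable fun p : 𝒳 × 𝒳 × 𝒳 => S μ h p.1 p.2.1 p.2.2 := by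
  simp only [S_eq_sum]
  refine (((Finset.measurable_fun_sum _ fun i _ => measurable_condE3 μ hh _ _ _).sub
    (Finset.measurable_fun_sum _ fun i _ => (measurable_condE2 μ hh _ _).comp
      (f := fun p : 𝒳 × 𝒳 × 𝒳 => (p.1, p.2.1)) (by fun_prop))).sub
    (Finset.measurable_fun_sum _ fun i _ => (measurable_condE2 μ hh _ _).comp
      (f := fun p : 𝒳 × 𝒳 × 𝒳 => p.2) (by fun_prop))).add
    (Finset.measurable_fun_sum _ fun i _ => (measurable_condE1 μ hh _).comp
      (f := fun p : 𝒳 × 𝒳 × 𝒳 => p.2.1) (by fun_prop))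

lemma abs_S_le (hC0 : 0 ≤ C) (hC : ∀ x, |h x| ≤ C) (x y z : 𝒳) : |S μ h x y z| ≤ 4 * (T * C) := by
  rw [S_eq_sum]
  have h1 := abs_sum_range_le (N := T) (n := T - 2) (by omega) hC0
    (fun i => abs_condE3_le μ hC (Fin.ofNat T i) (Fin.ofNat T (i + 1)) (Fin.ofNat T (i + 2)) x y z)
  have h2 := abs_sum_range_le (N := T) (n := T - 2) (by omega) hC0
    (fun i => abs_condE2_le μ hC (Fin.ofNat T i) (Fin.ofNat T (i + 1)) x y)
  have h3 := abs_sum_range_le (N := T) (n := T - 2) (by omega) hC0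
    (fun i => abs_condE2_le μ hC (Fin.ofNat T (i + 1)) (Fin.ofNat T (i + 2)) y z)
  have h4 := abs_sum_range_le (N := T) (n := T - 2) (by omega) hC0
    (fun i => abs_condE1_le μ hC (Fin.ofNat T (i + 1)) y)
  rw [abs_le] at *
  constructor <;> linarith [h1.1, h1.2, h2.1, h2.2, h3.1, h3.2, h4.1, h4.2]

end InteractionBounds

/-! ### Leading terms and the bound for one chain -/

section ChainBound

variable {𝒳 : Type*} [MeasurableSpace 𝒳] {T : ℕ} [NeZero T] {μ : Measure 𝒳}
  [IsProbabilityMeasure μ] {L : 𝒳 → 𝒳 → NNReal} {V : 𝒳 → 𝒳 → 𝒳 → NNReal}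
  {P : Measure (Fin T → 𝒳)} {h : (Fin T → 𝒳) → ℝ} {C : ℝ} {η₁ η₂ : ℝ}

/-- `L - 1` is orthogonal to functions of either coordinate alone, because both marginals are `μ`.
Removing the one-variable sums from the sum of `condE2` leaves `R` minus its mean, whose squared
norm is `varR`. -/
lemma abs_integral_pair_main_le (hLV : IsTransition μ L V) (hη₁ : 0 ≤ η₁)
    (hl : MemLp (fun p : 𝒳 × 𝒳 => (L p.1 p.2 : ℝ) - 1) 2 (μ.prod μ))
    (hl₁ : ∫ p, ((L p.1 p.2 : ℝ) - 1) ^ 2 ∂(μ.prod μ) ≤ η₁)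
    (hh : Measurable h) (hC0 : 0 ≤ C) (hC : ∀ x, |h x| ≤ C) :
    |∫ p, ((L p.1 p.2 : ℝ) - 1) * (∑ i ∈ Finset.range (T - 1),
        condE2 μ h (Fin.ofNat T i) (Fin.ofNat T (i + 1)) p.1 p.2) ∂(μ.prod μ)|
      ≤ √(varR μ h * η₁) := by
  set r₀ : ℝ := ∫ p, R μ h p.1 p.2 ∂(μ.prod μ) with hr₀
  set a : 𝒳 → ℝ := fun x => ∑ i ∈ Finset.range (T - 1), condE1 μ h (Fin.ofNat T i) x with ha
  -- The constant is chosen so that subtracting `a + b` leaves exactly `R - r₀`.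
  set b : 𝒳 → ℝ := fun y => (∑ i ∈ Finset.range (T - 1), condE1 μ h (Fin.ofNat T (i + 1)) y)
    + (r₀ - ((T : ℝ) - 1) * E0 μ h) with hb
  have ham : Measurable a := Finset.measurable_fun_sum _ fun i _ => measurable_condE1 μ hh _
  have hbm : Measurable b :=
    (Finset.measurable_fun_sum _ fun i _ => measurable_condE1 μ hh _).add measurable_const
  have hak : ∀ x, |a x| ≤ T * C := fun x =>
    abs_sum_range_le (by omega) hC0 fun i => abs_condE1_le μ hC _ _
  have hbk : ∀ y, |b y| ≤ T * C + |r₀ - ((T : ℝ) - 1) * E0 μ h| := fun y =>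
    (abs_add_le _ _).trans (add_le_add_left (abs_sum_range_le (by omega) hC0 fun i =>
      abs_condE1_le μ hC _ _) _)
  have ia : Integrable (fun p : 𝒳 × 𝒳 => ((L p.1 p.2 : ℝ) - 1) * a p.1) (μ.prod μ) :=
    hl.integrable_mul (MemLp.of_bound (p := 2) (ham.comp measurable_fst).aestronglyMeasurable _
      (ae_of_all _ fun p => hak p.1))
  have ib : Integrable (fun p : 𝒳 × 𝒳 => ((L p.1 p.2 : ℝ) - 1) * b p.2) (μ.prod μ) :=
    hl.integrable_mul (MemLp.of_bound (p := 2) (hbm.comp measurable_snd).aestronglyMeasurable _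
      (ae_of_all _ fun p => hbk p.2))
  have h0 : ∫ p, ((L p.1 p.2 : ℝ) - 1) * (a p.1 + b p.2) ∂(μ.prod μ) = 0 := by
    simp only [mul_add]
    rw [integral_add ia ib,
      integral_sub_one_mul_comp_eq_zero hLV.measL hl measurable_fst
        (by rw [hLV.map_fst, measurePreserving_fst.map_eq]) ham hak,
      integral_sub_one_mul_comp_eq_zero hLV.measL hl measurable_snd
        (by rw [hLV.map_snd, measurePreserving_snd.map_eq]) hbm hbk, add_zero]
  have key := abs_integral_sub_one_mul_le hl hl₁ (c := fun p => ∑ i ∈ Finset.range (T - 1),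
        condE2 μ h (Fin.ofNat T i) (Fin.ofNat T (i + 1)) p.1 p.2)
    (d := fun p => a p.1 + b p.2) (K := T * C + (T * C + |r₀ - ((T : ℝ) - 1) * E0 μ h|))
    (Finset.measurable_fun_sum _ fun i _ => measurable_condE2 μ hh _ _)
    ((ham.comp measurable_fst).add (hbm.comp measurable_snd))
    (fun p => (abs_sum_range_le (by omega) hC0 fun i => abs_condE2_le μ hC _ _ _ _).trans
      (le_add_of_nonneg_right (by positivity)))
    (fun p => (abs_add_le _ _).trans (add_le_add (hak _) (hbk _))) h0
  refine key.trans_eq ?_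
  rw [← Real.sqrt_mul hη₁, mul_comm η₁, varR, variance_eq_integral (measurable_R hh).aemeasurable]
  congr 2
  refine integral_congr_ae (ae_of_all _ fun p => ?_)
  simp only [ha, hb, R_eq_sum, hr₀]
  ring

lemma integral_sq_le_of_map {Ω E : Type*} [MeasurableSpace Ω] [MeasurableSpace E]
    {A P₀ : Measure Ω} {π : Ω → E} (hπ : Measurable π) {g : E → ℝ} (hg : Measurable g) {K δ : ℝ}
    (hK : ∀ e, |g e| ≤ K)
    (hδ : ∀ f : Ω → ℝ, Measurable f → ∀ K : ℝ, (∀ x, |f x| ≤ K) →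
      |∫ x, f x ∂A - ∫ x, f x ∂P₀| ≤ K * δ) :
    ∫ e, g e ^ 2 ∂(A.map π) ≤ ∫ e, g e ^ 2 ∂(P₀.map π) + K ^ 2 * δ := by
  rw [integral_map hπ.aemeasurable (by fun_prop), integral_map hπ.aemeasurable (by fun_prop)]
  have := hδ (fun x => g (π x) ^ 2) (by fun_prop) (K ^ 2) (fun x => by
    rw [abs_pow]
    exact pow_le_pow_left₀ (abs_nonneg _) (hK _) 2)
  linarith [(abs_le.1 this).2]

lemma sqrt_add_le_add_sqrt (a : ℝ) {b : ℝ} (hb : 0 ≤ b) : √(a + b) ≤ √a + √b := by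
  rcases le_total 0 a with ha | ha
  · refine Real.sqrt_le_iff.2 ⟨by positivity, ?_⟩
    nlinarith [Real.sq_sqrt ha, Real.sq_sqrt hb, mul_nonneg (Real.sqrt_nonneg a)
      (Real.sqrt_nonneg b)]
  · exact (Real.sqrt_le_sqrt (by linarith)).trans (le_add_of_nonneg_left (Real.sqrt_nonneg _))

/-- `V - 1` is orthogonal to functions of `(x, y)` and of `(y, z)`, but in `L²(markovTriple μ L)`.
Cauchy–Schwarz thus yields the second moment of the centred `S` under the Markov triple; passing to
the product law produces the extra term. -/
lemma abs_integral_triple_main_le (hP : IsChainLaw μ L V P) [IsProbabilityMeasure P]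
    (hT : 2 < T) (hη₂ : 0 ≤ η₂)
    (hl : MemLp (fun p : 𝒳 × 𝒳 => (L p.1 p.2 : ℝ) - 1) 2 (μ.prod μ))
    (hl₁ : ∫ p, ((L p.1 p.2 : ℝ) - 1) ^ 2 ∂(μ.prod μ) ≤ η₁)
    (hs : MemLp (fun p : 𝒳 × 𝒳 × 𝒳 => (V p.1 p.2.1 p.2.2 : ℝ) - 1) 2 (markovTriple μ L))
    (hs₂ : ∫ p, ((V p.1 p.2.1 p.2.2 : ℝ) - 1) ^ 2 ∂(markovTriple μ L) ≤ η₂)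
    (hh : Measurable h) (hC0 : 0 ≤ C) (hC : ∀ x, |h x| ≤ C) :
    |∫ p, ((V p.1 p.2.1 p.2.2 : ℝ) - 1) * (∑ i ∈ Finset.range (T - 2),
        condE3 μ h (Fin.ofNat T i) (Fin.ofNat T (i + 1)) (Fin.ofNat T (i + 2)) p.1 p.2.1 p.2.2)
        ∂(markovTriple μ L)|
      ≤ √(varS μ h * η₂) + √η₂ * (8 * (T * C) * √(T * (√η₁ + √η₂))) := by
  have hLV := hP.toIsTransition
  have hprob := hLV.isProbabilityMeasure_markovTriple
  set s₀ : ℝ := ∫ p, S μ h p.1 p.2.1 p.2.2 ∂(μ.prod (μ.prod μ)) with hs₀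
  have hs₀b : |s₀| ≤ 4 * (T * C) := by
    have := norm_integral_le_of_norm_le_const (μ := μ.prod (μ.prod μ))
      (f := fun p : 𝒳 × 𝒳 × 𝒳 => S μ h p.1 p.2.1 p.2.2)
      (ae_of_all _ fun p => abs_S_le hC0 hC p.1 p.2.1 p.2.2)
    simpa using this
  set a : 𝒳 × 𝒳 → ℝ := fun q =>
    ∑ i ∈ Finset.range (T - 2), condE2 μ h (Fin.ofNat T i) (Fin.ofNat T (i + 1)) q.1 q.2 with ha
  -- The `condE1` term depends on the middle state only and is absorbed into the function of `(y,
  -- z)`; `s₀` centres `S`.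
  set b : 𝒳 × 𝒳 → ℝ := fun q =>
    (∑ i ∈ Finset.range (T - 2), condE2 μ h (Fin.ofNat T (i + 1)) (Fin.ofNat T (i + 2)) q.1 q.2)
    + (s₀ - ∑ i ∈ Finset.range (T - 2), condE1 μ h (Fin.ofNat T (i + 1)) q.1) with hb
  have ham : Measurable a := Finset.measurable_fun_sum _ fun i _ => measurable_condE2 μ hh _ _
  have hbm : Measurable b :=
    (Finset.measurable_fun_sum _ fun i _ => measurable_condE2 μ hh _ _).add
      (measurable_const.sub (Finset.measurable_fun_sum _ fun i _ =>
        (measurable_condE1 μ hh _).comp measurable_fst))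
  have hak : ∀ x, |a x| ≤ T * C := fun x =>
    abs_sum_range_le (by omega) hC0 fun i => abs_condE2_le μ hC _ _ _ _
  have hbk : ∀ y, |b y| ≤ T * C + (|s₀| + T * C) := fun y =>
    (abs_add_le _ _).trans (add_le_add (abs_sum_range_le (by omega) hC0 fun i =>
      abs_condE2_le μ hC _ _ _ _) ((abs_sub _ _).trans (add_le_add_right
        (abs_sum_range_le (by omega) hC0 fun i => abs_condE1_le μ hC _ _) _)))
  have m12 : Measurable fun p : 𝒳 × 𝒳 × 𝒳 => (p.1, p.2.1) := by fun_prop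
  have ia : Integrable (fun p : 𝒳 × 𝒳 × 𝒳 => ((V p.1 p.2.1 p.2.2 : ℝ) - 1) * a (p.1, p.2.1))
      (markovTriple μ L) :=
    hs.integrable_mul (MemLp.of_bound (p := 2) (ham.comp m12).aestronglyMeasurable _
      (ae_of_all _ fun p => hak _))
  have ib : Integrable (fun p : 𝒳 × 𝒳 × 𝒳 => ((V p.1 p.2.1 p.2.2 : ℝ) - 1) * b p.2)
      (markovTriple μ L) :=
    hs.integrable_mul (MemLp.of_bound (p := 2) (hbm.comp measurable_snd).aestronglyMeasurable _
      (ae_of_all _ fun p => hbk p.2))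
  have ht := hP.tripleLaw_eq 0 hT
  rw [← hLV.withDensity_markovTriple, tripleLaw] at ht
  -- Both the triple law of `P` and the Markov triple have the pair law with density `L` as first
  -- marginal pair, and likewise as second.
  have mapa : ((markovTriple μ L).withDensity fun p => (V p.1 p.2.1 p.2.2 : ℝ≥0∞)).map
      (fun p => (p.1, p.2.1)) = (markovTriple μ L).map (fun p => (p.1, p.2.1)) := by
    rw [hLV.map_markovTriple_left, ← hP.pairLaw_eq 0 (by omega), ← ht,
      Measure.map_map m12 (by fun_prop)]
    rfl
  have mapb : ((markovTriple μ L).withDensity fun p => (V p.1 p.2.1 p.2.2 : ℝ≥0∞)).map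
      (fun p => p.2) = (markovTriple μ L).map (fun p => p.2) := by
    rw [hLV.map_markovTriple_right, ← hP.pairLaw_eq 1 (by omega), ← ht,
      Measure.map_map measurable_snd (by fun_prop)]
    rfl
  have h0 : ∫ p, ((V p.1 p.2.1 p.2.2 : ℝ) - 1) * (a (p.1, p.2.1) + b p.2)
      ∂(markovTriple μ L) = 0 := by
    simp only [mul_add]
    rw [integral_add ia ib,
      integral_sub_one_mul_comp_eq_zero hLV.measV hs m12 mapa ham hak,
      integral_sub_one_mul_comp_eq_zero hLV.measV hs measurable_snd mapb hbm hbk, add_zero]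
  have key := abs_integral_sub_one_mul_le hs hs₂ (c := fun p => ∑ i ∈ Finset.range (T - 2),
      condE3 μ h (Fin.ofNat T i) (Fin.ofNat T (i + 1)) (Fin.ofNat T (i + 2)) p.1 p.2.1 p.2.2)
    (d := fun p => a (p.1, p.2.1) + b p.2) (K := T * C + (T * C + (|s₀| + T * C)))
    (Finset.measurable_fun_sum _ fun i _ => measurable_condE3 μ hh _ _ _)
    ((ham.comp m12).add (hbm.comp measurable_snd))
    (fun p => (abs_sum_range_le (by omega) hC0 fun i => abs_condE3_le μ hC _ _ _ _ _ _).trans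
      (le_add_of_nonneg_right (by positivity)))
    (fun p => (abs_add_le _ _).trans (add_le_add (hak _) (hbk _))) h0
  refine key.trans ?_
  have hsq : ∫ p, ((∑ i ∈ Finset.range (T - 2), condE3 μ h (Fin.ofNat T i)
      (Fin.ofNat T (i + 1)) (Fin.ofNat T (i + 2)) p.1 p.2.1 p.2.2)
      - (a (p.1, p.2.1) + b p.2)) ^ 2 ∂(markovTriple μ L)
      -- `S` and its mean are each bounded by `4 * (T * C)`.
      ≤ varS μ h + (8 * (T * C)) ^ 2 * (T * (√η₁ + √η₂)) := by
    have e : ∀ p : 𝒳 × 𝒳 × 𝒳, (∑ i ∈ Finset.range (T - 2), condE3 μ h (Fin.ofNat T i)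
      (Fin.ofNat T (i + 1)) (Fin.ofNat T (i + 2)) p.1 p.2.1 p.2.2)
      - (a (p.1, p.2.1) + b p.2) = S μ h p.1 p.2.1 p.2.2 - s₀ := fun p => by
      simp only [ha, hb, S_eq_sum]; ring
    simp_rw [e]
    have e1 : markovTriple μ L = (hybrid μ L V T (T - 1) 0).map
        (fun x => (x (Fin.ofNat T 0), x (Fin.ofNat T 1), x (Fin.ofNat T 2))) :=
      (tripleLaw_hybrid hP hT hT).symm
    have e2 : μ.prod (μ.prod μ) = (baseline μ T).map
        (fun x => (x (Fin.ofNat T 0), x (Fin.ofNat T 1), x (Fin.ofNat T 2))) :=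
      (map_eval_triple_baseline μ (ofNat_ne (by omega) (by omega) (by omega))
        (ofNat_ne (by omega) (by omega) (by omega))
        (ofNat_ne (by omega) (by omega) (by omega))).symm
    rw [varS, variance_eq_integral (measurable_S hh).aemeasurable, ← hs₀]
    rw [e1, e2]
    refine integral_sq_le_of_map (by fun_prop) ((measurable_S hh).sub measurable_const)
      (fun p => ?_) fun f hf K hK => ?_
    · exact (abs_sub _ _).trans (by linarith [abs_S_le (μ := μ) hC0 hC p.1 p.2.1 p.2.2])
    · have : Nonempty (Fin T → 𝒳) := (baseline μ T).nonempty_of_neZero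
      refine (abs_integral_hybrid_pair_sub_le hLV hl hl₁ hf hK (k := T - 1) (by omega)).trans ?_
      refine mul_le_mul_of_nonneg_left ?_ ((abs_nonneg _).trans (hK this.some))
      have e3 : ((T - 1 : ℕ) : ℝ) ≤ T := by exact_mod_cast (by omega : T - 1 ≤ T)
      exact mul_le_mul e3 (by linarith [Real.sqrt_nonneg η₂]) (Real.sqrt_nonneg _) (by positivity)
  calc √η₂ * √(∫ p, ((∑ i ∈ Finset.range (T - 2), condE3 μ h (Fin.ofNat T i)
        (Fin.ofNat T (i + 1)) (Fin.ofNat T (i + 2)) p.1 p.2.1 p.2.2)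
        - (a (p.1, p.2.1) + b p.2)) ^ 2 ∂(markovTriple μ L))
      ≤ √η₂ * (√(varS μ h) + √((8 * (T * C)) ^ 2 * (T * (√η₁ + √η₂)))) :=
        mul_le_mul_of_nonneg_left ((Real.sqrt_le_sqrt hsq).trans
          (sqrt_add_le_add_sqrt _ (by positivity))) (Real.sqrt_nonneg _)
    _ = _ := by
      rw [Real.sqrt_mul (by positivity), Real.sqrt_sq (by positivity), mul_add,
        mul_comm (varS μ h), Real.sqrt_mul hη₂]

/-- First-order bound, with explicit remainder, for the law of a chain of order two. -/
theorem IsChainLaw.abs_integral_sub_le (hP : IsChainLaw μ L V P) [IsProbabilityMeasure P]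
    (hT : 2 < T) (hη₁ : 0 ≤ η₁) (hη₂ : 0 ≤ η₂)
    (hl : MemLp (fun p : 𝒳 × 𝒳 => (L p.1 p.2 : ℝ) - 1) 2 (μ.prod μ))
    (hl₁ : ∫ p, ((L p.1 p.2 : ℝ) - 1) ^ 2 ∂(μ.prod μ) ≤ η₁)
    (hs : MemLp (fun p : 𝒳 × 𝒳 × 𝒳 => (V p.1 p.2.1 p.2.2 : ℝ) - 1) 2 (markovTriple μ L))
    (hs₂ : ∫ p, ((V p.1 p.2.1 p.2.2 : ℝ) - 1) ^ 2 ∂(markovTriple μ L) ≤ η₂)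
    (hh : Measurable h) (hC0 : 0 ≤ C) (hC : ∀ x, |h x| ≤ C) :
    |∫ x, h x ∂P - E0 μ h| ≤ √(varR μ h * η₁) + √(varS μ h * η₂)
      + 10 * (T * C) * √(T * (√η₁ + √η₂)) * (√η₁ + √η₂) := by
  have hLV := hP.toIsTransition
  have h1 := abs_integral_hybrid_pair_expansion_le (η₂ := η₂) hLV hl hl₁ hh hC (k := T - 1)
    (by omega)
  have h2 := abs_integral_hybrid_triple_expansion_le hP hT hl hl₁ hs hs₂ hh hC (m := T - 2)
    (by omega)
  have h3 := abs_integral_pair_main_le hLV hη₁ hl hl₁ hh hC0 hC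
  have h4 := abs_integral_triple_main_le hP hT hη₂ hl hl₁ hs hs₂ hh hC0 hC
  rw [hybrid_full hP hT] at h2
  have e1 : ((T - 1 : ℕ) : ℝ) ≤ T := by exact_mod_cast (by omega : T - 1 ≤ T)
  have e2 : ((T - 2 : ℕ) : ℝ) ≤ T := by exact_mod_cast (by omega : T - 2 ≤ T)
  have h1' := h1.trans (mul_le_mul_of_nonneg_right e1 (by positivity))
  have h2' := h2.trans (mul_le_mul_of_nonneg_right e2 (by positivity))
  -- The remainders have coefficient `2TC` on `√η₁` and `2TC + 8TC` on `√η₂`; this term raises the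
  -- first to the common value `10TC`.
  have hpos : 0 ≤ 8 * (T * C) * √(T * (√η₁ + √η₂)) * √η₁ := by positivity
  rw [abs_le] at *
  constructor <;> linarith [h1'.1, h1'.2, h2'.1, h2'.2, h3.1, h3.2, h4.1, h4.2]

end ChainBound

/-! ### Densities extracted from the χ² bounds -/

section Densities

lemma ae_eq_one_of_withDensity_eq {E : Type*} [MeasurableSpace E] {ν : Measure E}
    [IsFiniteMeasure ν] {f : E → ℝ≥0∞} (hf : Measurable f) (h : ν.withDensity f = ν) :
    ∀ᵐ e ∂ν, f e = 1 := by
  refine (withDensity_eq_iff hf.aemeasurable aemeasurable_one ?_).1 (by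
    rw [h]; exact withDensity_one.symm)
  have := DFunLike.congr_fun h Set.univ
  rw [withDensity_apply _ MeasurableSet.univ, Measure.restrict_univ] at this
  rw [this]
  exact measure_ne_top _ _

/-- A finite bound excludes the `⊤` branch, hence forces absolute continuity. The estimate is given
for every version `g'` because the density is later modified on a null set. -/
lemma exists_density_of_chiSq_le {E : Type*} [MeasurableSpace E] {P₁ P₂ : Measure E}
    [IsFiniteMeasure P₁] [IsFiniteMeasure P₂] {η : ℝ} (hη : 0 ≤ η)
    (h : chiSq P₁ P₂ ≤ ENNReal.ofReal η) :
    ∃ g : E → NNReal, Measurable g ∧ P₁ = P₂.withDensity (fun e => (g e : ℝ≥0∞)) ∧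
      ∀ g' : E → NNReal, Measurable g' → (∀ᵐ e ∂P₂, g' e = g e) →
        MemLp (fun e => (g' e : ℝ) - 1) 2 P₂ ∧ ∫ e, ((g' e : ℝ) - 1) ^ 2 ∂P₂ ≤ η := by
  have hac : P₁ ≪ P₂ := by
    by_contra hn
    rw [chiSq, if_neg hn] at h
    exact ENNReal.ofReal_ne_top (top_le_iff.1 h)
  rw [chiSq, if_pos hac] at h
  refine ⟨fun e => (P₁.rnDeriv P₂ e).toNNReal, (Measure.measurable_rnDeriv _ _).ennreal_toNNReal,
    ?_, fun g' hg' hgg => ?_⟩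
  · conv_lhs => rw [← Measure.withDensity_rnDeriv_eq P₁ P₂ hac]
    refine withDensity_congr_ae ?_
    filter_upwards [Measure.rnDeriv_lt_top P₁ P₂] with e he
    exact (ENNReal.coe_toNNReal he.ne).symm
  · have e1 : ∫⁻ e, ENNReal.ofReal (((g' e : ℝ) - 1) ^ 2) ∂P₂ ≤ ENNReal.ofReal η := by
      refine (lintegral_congr_ae ?_).trans_le h
      filter_upwards [hgg] with e he
      rw [he]; rfl
    have hm : Measurable fun e => (g' e : ℝ) - 1 := by fun_prop
    constructor
    · rw [memLp_two_iff_integrable_sq hm.aestronglyMeasurable]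
      refine ⟨(hm.pow_const 2).aestronglyMeasurable, ?_⟩
      rw [hasFiniteIntegral_iff_ofReal (ae_of_all _ fun _ => sq_nonneg _)]
      exact e1.trans_lt ENNReal.ofReal_lt_top
    · rw [integral_eq_lintegral_of_nonneg_ae (ae_of_all _ fun _ => sq_nonneg _)
        (hm.pow_const 2).aestronglyMeasurable]
      exact ENNReal.toReal_le_of_le_ofReal hη e1

variable {𝒳 : Type*} [MeasurableSpace 𝒳] {μ : Measure 𝒳} [IsProbabilityMeasure μ]

lemma ae_lintegral_right_eq_one {f : 𝒳 × 𝒳 → ℝ≥0∞} (hf : Measurable f)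
    (h : ((μ.prod μ).withDensity f).map Prod.fst = μ) :
    ∀ᵐ x ∂μ, ∫⁻ z, f (x, z) ∂μ = 1 := by
  refine ae_eq_one_of_withDensity_eq hf.lintegral_prod_right' ?_
  conv_rhs => rw [← h]
  refine Measure.ext_of_lintegral _ fun φ hφ => ?_
  rw [lintegral_map hφ measurable_fst,
    lintegral_withDensity_eq_lintegral_mul _ hf.lintegral_prod_right' hφ,
    lintegral_withDensity_eq_lintegral_mul _ hf (g := fun p => φ p.1) (by fun_prop),
    lintegral_prod _ (by fun_prop)]
  refine lintegral_congr fun x => ?_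
  simp only [Pi.mul_apply]
  rw [lintegral_mul_const (φ x) (f := fun z => f (x, z)) (hf.comp measurable_prodMk_left)]

lemma ae_lintegral_left_eq_one {f : 𝒳 × 𝒳 → ℝ≥0∞} (hf : Measurable f)
    (h : ((μ.prod μ).withDensity f).map Prod.snd = μ) :
    ∀ᵐ z ∂μ, ∫⁻ x, f (x, z) ∂μ = 1 := by
  refine ae_eq_one_of_withDensity_eq hf.lintegral_prod_left' ?_
  conv_rhs => rw [← h]
  refine Measure.ext_of_lintegral _ fun φ hφ => ?_
  rw [lintegral_map hφ measurable_snd,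
    lintegral_withDensity_eq_lintegral_mul _ hf.lintegral_prod_left' hφ,
    lintegral_withDensity_eq_lintegral_mul _ hf (g := fun p => φ p.2) (by fun_prop),
    lintegral_prod_symm _ (by fun_prop)]
  refine lintegral_congr fun x => ?_
  simp only [Pi.mul_apply]
  rw [lintegral_mul_const (φ x) (f := fun z => f (z, x)) (hf.comp measurable_prodMk_right)]

/-- A bivariate law close to independence has a density all of whose sections integrate to one. -/
lemma exists_pair_density {ν : Measure (𝒳 × 𝒳)} [IsProbabilityMeasure ν] {η : ℝ} (hη : 0 ≤ η)
    (h₁ : ν.map Prod.fst = μ) (h₂ : ν.map Prod.snd = μ) (h : phiSq ν ≤ ENNReal.ofReal η) :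
    ∃ L : 𝒳 → 𝒳 → NNReal, IsTransition μ L (fun _ _ _ => 1) ∧
      ν = (μ.prod μ).withDensity (fun p => (L p.1 p.2 : ℝ≥0∞)) ∧
      MemLp (fun p : 𝒳 × 𝒳 => (L p.1 p.2 : ℝ) - 1) 2 (μ.prod μ) ∧
      ∫ p, ((L p.1 p.2 : ℝ) - 1) ^ 2 ∂(μ.prod μ) ≤ η := by
  classical
  rw [phiSq, h₁, h₂] at h
  obtain ⟨g, hg, hνg, hg2⟩ := exists_density_of_chiSq_le hη h
  have hg' : Measurable fun p => (g p : ℝ≥0∞) := hg.coe_nnreal_ennreal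
  set r : 𝒳 → ℝ≥0∞ := fun x => ∫⁻ z, (g (x, z) : ℝ≥0∞) ∂μ with hr
  set l : 𝒳 → ℝ≥0∞ := fun z => ∫⁻ x, (g (x, z) : ℝ≥0∞) ∂μ with hl
  have hrm : Measurable r := hg'.lintegral_prod_right'
  have hlm : Measurable l := hg'.lintegral_prod_left'
  have hr1 : ∀ᵐ x ∂μ, r x = 1 := ae_lintegral_right_eq_one hg' (by rw [← hνg, h₁])
  have hl1 : ∀ᵐ z ∂μ, l z = 1 := ae_lintegral_left_eq_one hg' (by rw [← hνg, h₂])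
  -- A good row changes only on the null set of bad columns and keeps integral one; a bad row
  -- becomes constantly 1, of integral one as `μ` is a probability measure. Columns are symmetric.
  set L : 𝒳 → 𝒳 → NNReal := fun x z => if r x = 1 ∧ l z = 1 then g (x, z) else 1 with hL
  have hLm : Measurable fun p : 𝒳 × 𝒳 => L p.1 p.2 :=
    Measurable.ite (((hrm.comp measurable_fst) (measurableSet_singleton 1)).inter
      ((hlm.comp measurable_snd) (measurableSet_singleton 1))) hg measurable_const
  have hright : ∀ x, ∫⁻ z, (L x z : ℝ≥0∞) ∂μ = 1 := fun x => by
    by_cases hx : r x = 1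
    · refine (lintegral_congr_ae ?_).trans hx
      filter_upwards [hl1] with z hz
      simp [hL, hx, hz]
    · simp [hL, hx]
  have hleft : ∀ z, ∫⁻ x, (L x z : ℝ≥0∞) ∂μ = 1 := fun z => by
    by_cases hz : l z = 1
    · refine (lintegral_congr_ae ?_).trans hz
      filter_upwards [hr1] with x hx
      simp [hL, hx, hz]
    · simp [hL, hz]
  have hae : ∀ᵐ p ∂(μ.prod μ), L p.1 p.2 = g p := by
    filter_upwards [Measure.quasiMeasurePreserving_fst.ae hr1,
      Measure.quasiMeasurePreserving_snd.ae hl1] with p h3 h4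
    simp [hL, h3, h4]
  obtain ⟨h5, h6⟩ := hg2 (fun p => L p.1 p.2) hLm hae
  refine ⟨L, ⟨hLm, measurable_const, hright, hleft, fun x y => by simpa using hright y⟩, ?_, h5, h6⟩
  rw [hνg]
  refine withDensity_congr_ae ?_
  filter_upwards [hae] with p hp
  rw [hp]

/-- A trivariate law `χ²`-close to that of the Markov chain with the same pair laws is that of a
chain of order two. -/
lemma exists_triple_density {L : 𝒳 → 𝒳 → NNReal} (hL : IsTransition μ L (fun _ _ _ => 1))
    {ν : Measure (𝒳 × 𝒳 × 𝒳)} [IsProbabilityMeasure ν] {η : ℝ} (hη : 0 ≤ η)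
    (h₁ : ν.map (fun p => (p.1, p.2.1)) = (μ.prod μ).withDensity fun p => (L p.1 p.2 : ℝ≥0∞))
    (h : chiSq ν (markovTriple μ L) ≤ ENNReal.ofReal η) :
    ∃ V : 𝒳 → 𝒳 → 𝒳 → NNReal, IsTransition μ L V ∧
      ν = (μ.prod (μ.prod μ)).withDensity (fun p => (L p.1 p.2.1 : ℝ≥0∞)
        * ((L p.2.1 p.2.2 : ℝ≥0∞) * (V p.1 p.2.1 p.2.2 : ℝ≥0∞))) ∧
      MemLp (fun p : 𝒳 × 𝒳 × 𝒳 => (V p.1 p.2.1 p.2.2 : ℝ) - 1) 2 (markovTriple μ L) ∧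
      ∫ p, ((V p.1 p.2.1 p.2.2 : ℝ) - 1) ^ 2 ∂(markovTriple μ L) ≤ η := by
  classical
  have := hL.isProbabilityMeasure_markovTriple
  obtain ⟨g, hg, hνg, hg2⟩ := exists_density_of_chiSq_le hη h
  have hg' : Measurable fun p => (g p : ℝ≥0∞) := hg.coe_nnreal_ennreal
  have m12 : Measurable fun p : 𝒳 × 𝒳 × 𝒳 => (p.1, p.2.1) := by fun_prop
  have hK : Measurable fun p : 𝒳 × 𝒳 × 𝒳 => (L p.2.1 p.2.2 : ℝ≥0∞) * (g p : ℝ≥0∞) :=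
    hL.measurable_markov.mul hg'
  set r : 𝒳 × 𝒳 → ℝ≥0∞ := fun q => ∫⁻ z, (L q.2 z : ℝ≥0∞) * (g (q.1, q.2, z) : ℝ≥0∞) ∂μ with hr
  have hrm : Measurable r := Measurable.lintegral_prod_right' (f := fun p : (𝒳 × 𝒳) × 𝒳 =>
    (L p.1.2 p.2 : ℝ≥0∞) * (g (p.1.1, p.1.2, p.2) : ℝ≥0∞))
    (hK.comp (f := fun p : (𝒳 × 𝒳) × 𝒳 => (p.1.1, p.1.2, p.2)) (by fun_prop))
  have hνd : ν = (μ.prod (μ.prod μ)).withDensity (fun p => (L p.1 p.2.1 : ℝ≥0∞)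
      * ((L p.2.1 p.2.2 : ℝ≥0∞) * (g p : ℝ≥0∞))) := by
    have e1 := hL.measurable_markov
    have e2 := hL.measurable_markov'
    rw [hνg, markovTriple, ← withDensity_mul _ (by fun_prop) hg']
    congr 1
    funext p
    simp [mul_assoc]
  have hfin : IsFiniteMeasure ((μ.prod μ).withDensity fun p => (L p.1 p.2 : ℝ≥0∞)) := by
    rw [← h₁]; infer_instance
  -- `r` is the density of the first pair law of `ν` with respect to that of the Markov triple, and
  -- these two pair laws coincide.
  have hr1 : ∀ᵐ q ∂((μ.prod μ).withDensity fun p => (L p.1 p.2 : ℝ≥0∞)), r q = 1 := by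
    refine ae_eq_one_of_withDensity_eq hrm ?_
    conv_rhs => rw [← h₁]
    refine Measure.ext_of_lintegral _ fun φ hφ => ?_
    rw [lintegral_withDensity_eq_lintegral_mul _ hrm hφ, lintegral_map hφ m12, hνd,
      hL.lintegral_triple hK (φ := fun p => φ (p.1, p.2.1)) (hφ.comp m12)]
    refine lintegral_congr fun q => ?_
    simp only [Pi.mul_apply]
    rw [lintegral_const_mul (φ (q.1, q.2))
      (f := fun z => (L q.2 z : ℝ≥0∞) * (g (q.1, q.2, z) : ℝ≥0∞))
      (hK.comp (f := fun z => (q.1, q.2, z)) (by fun_prop)), mul_comm]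
  -- Where `r` differs from 1, the transition falls back to `L`, already normalized.
  set V : 𝒳 → 𝒳 → 𝒳 → NNReal := fun x y z => if r (x, y) = 1 then g (x, y, z) else 1 with hV
  have hVm : Measurable fun p : 𝒳 × 𝒳 × 𝒳 => V p.1 p.2.1 p.2.2 :=
    Measurable.ite ((hrm.comp m12) (measurableSet_singleton 1)) hg measurable_const
  have htwo : ∀ x y, ∫⁻ z, (L y z : ℝ≥0∞) * (V x y z : ℝ≥0∞) ∂μ = 1 := fun x y => by
    by_cases hx : r (x, y) = 1
    · simp only [hV, if_pos hx]
      exact hx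
    · simpa [hV, hx] using hL.right y
  have hae : ∀ᵐ p ∂(markovTriple μ L), V p.1 p.2.1 p.2.2 = g p := by
    rw [← hL.map_markovTriple_left] at hr1
    filter_upwards [ae_of_ae_map m12.aemeasurable hr1] with p hp
    simp [hV, hp]
  obtain ⟨h5, h6⟩ := hg2 (fun p => V p.1 p.2.1 p.2.2) hVm hae
  have hT : IsTransition μ L V := ⟨hL.measL, hVm, hL.right, hL.left, htwo⟩
  refine ⟨V, hT, ?_, h5, h6⟩
  rw [← hT.withDensity_markovTriple, hνg]
  refine withDensity_congr_ae ?_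
  filter_upwards [hae] with p hp
  rw [hp]

end Densities

/-! ### Feasible laws are chains of order two -/

section Feasible

variable {𝒳 : Type*} [MeasurableSpace 𝒳] {T : ℕ} [NeZero T] {μ : Measure 𝒳}
  {P : Measure (Fin T → 𝒳)}

lemma IsStationary.pairLaw_eq (hP : IsStationary P) {n : ℕ} (hn : n + 1 < T) :
    pairLaw P (Fin.ofNat T n) (Fin.ofNat T (n + 1)) = pairLaw P (Fin.ofNat T 0) (Fin.ofNat T 1) := by
  have h := congrArg (fun ν => ν.map fun y : Fin 2 → 𝒳 => (y 0, y 1)) (hP 2 n (by omega))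
  rw [Measure.map_map (by fun_prop) (by fun_prop), Measure.map_map (by fun_prop) (by fun_prop)] at h
  simp only [pairLaw, ← ofNat_eq_mk (show n < T by omega), ← ofNat_eq_mk hn,
    ← ofNat_eq_mk (show 0 < T by omega), ← ofNat_eq_mk (show 1 < T by omega)]
  exact h

lemma IsStationary.tripleLaw_eq (hP : IsStationary P) {n : ℕ} (hn : n + 2 < T) :
    tripleLaw P (Fin.ofNat T n) (Fin.ofNat T (n + 1)) (Fin.ofNat T (n + 2))
      = tripleLaw P (Fin.ofNat T 0) (Fin.ofNat T 1) (Fin.ofNat T 2) := by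
  have h := congrArg (fun ν => ν.map fun y : Fin 3 → 𝒳 => (y 0, y 1, y 2)) (hP 3 n (by omega))
  rw [Measure.map_map (by fun_prop) (by fun_prop), Measure.map_map (by fun_prop) (by fun_prop)] at h
  simp only [tripleLaw, ← ofNat_eq_mk (show n < T by omega),
    ← ofNat_eq_mk (show n + 1 < T by omega), ← ofNat_eq_mk hn,
    ← ofNat_eq_mk (show 0 < T by omega), ← ofNat_eq_mk (show 1 < T by omega),
    ← ofNat_eq_mk (show 2 < T by omega)]
  exact h

variable [IsProbabilityMeasure μ] {η₁ η₂ : ℝ}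

/-- Stationarity lets one `L` and one `V` serve at all times. The counterpart `Q` enters through its
first three states only, whose law is forced to be `markovTriple μ L` by 1-dependence and the shared
pair laws. -/
lemma IsFeasible.exists_isChainLaw (hP : IsFeasible μ η₁ η₂ P) (hT : 2 < T) (hη₁ : 0 ≤ η₁)
    (hη₂ : 0 ≤ η₂) :
    ∃ (L : 𝒳 → 𝒳 → NNReal) (V : 𝒳 → 𝒳 → 𝒳 → NNReal), IsChainLaw μ L V P ∧
      MemLp (fun p : 𝒳 × 𝒳 => (L p.1 p.2 : ℝ) - 1) 2 (μ.prod μ) ∧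
      ∫ p, ((L p.1 p.2 : ℝ) - 1) ^ 2 ∂(μ.prod μ) ≤ η₁ ∧
      MemLp (fun p : 𝒳 × 𝒳 × 𝒳 => (V p.1 p.2.1 p.2.2 : ℝ) - 1) 2 (markovTriple μ L) ∧
      ∫ p, ((V p.1 p.2.1 p.2.2 : ℝ) - 1) ^ 2 ∂(markovTriple μ L) ≤ η₂ := by
  have hprob := hP.isProbabilityMeasure
  have val : ∀ i, i < T → ((Fin.ofNat T i : Fin T) : ℕ) = i := fun i hi => Nat.mod_eq_of_lt hi
  have v0 := val 0 (by omega)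
  have v1 := val 1 (by omega)
  have v2 := val 2 (by omega)
  have m01 : Measurable fun x : Fin T → 𝒳 => (x (Fin.ofNat T 0), x (Fin.ofNat T 1)) := by
    fun_prop
  have m012 : Measurable fun x : Fin T → 𝒳 =>
    (x (Fin.ofNat T 0), x (Fin.ofNat T 1), x (Fin.ofNat T 2)) := by fun_prop
  have p1 : IsProbabilityMeasure (pairLaw P (Fin.ofNat T 0) (Fin.ofNat T 1)) :=
    Measure.isProbabilityMeasure_map m01.aemeasurable
  have p2 : IsProbabilityMeasure (tripleLaw P (Fin.ofNat T 0) (Fin.ofNat T 1) (Fin.ofNat T 2)) :=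
    Measure.isProbabilityMeasure_map m012.aemeasurable
  obtain ⟨L, hL, hpair, hl, hl₁⟩ := exists_pair_density (μ := μ) hη₁
    (ν := pairLaw P (Fin.ofNat T 0) (Fin.ofNat T 1))
    (by rw [pairLaw, Measure.map_map measurable_fst m01]; exact hP.marginal _)
    (by rw [pairLaw, Measure.map_map measurable_snd m01]; exact hP.marginal _)
    (hP.lagOne _ _ (by omega))
  have hpairs : ∀ n, n + 1 < T → pairLaw P (Fin.ofNat T n) (Fin.ofNat T (n + 1))
      = (μ.prod μ).withDensity fun p => (L p.1 p.2 : ℝ≥0∞) := fun n hn =>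
    (hP.isStationary.pairLaw_eq hn).trans hpair
  obtain ⟨Q, hQ, hchi⟩ := hP.lagTwo
  have hQp := hQ.isProbabilityMeasure
  have hQpairs : ∀ n, n + 1 < T → pairLaw Q (Fin.ofNat T n) (Fin.ofNat T (n + 1))
      = (μ.prod μ).withDensity fun p => (L p.1 p.2 : ℝ≥0∞) := fun n hn => by
    rw [hQ.pairLaw_eq _ _ (by rw [val _ hn, val _ (by omega)]), hpairs n hn]
  have hQ3 : tripleLaw Q (Fin.ofNat T 0) (Fin.ofNat T 1) (Fin.ofNat T 2) = markovTriple μ L :=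
    hL.tripleLaw_of_isDependent_one hQ.isDependent (n := 0) hT (hQpairs 0 (by omega))
      (hQpairs 1 hT)
  obtain ⟨V, hV, htriple, hs, hs₂⟩ := exists_triple_density hL hη₂
    (ν := tripleLaw P (Fin.ofNat T 0) (Fin.ofNat T 1) (Fin.ofNat T 2))
    (by
      rw [← hpair, tripleLaw, pairLaw, Measure.map_map (by fun_prop) m012]
      rfl)
    (by rw [← hQ3]; exact hchi _ _ _ (by omega) (by omega))
  exact ⟨L, V, ⟨hV, hP.isDependent, hpairs, fun n hn =>
    (hP.isStationary.tripleLaw_eq hn).trans htriple⟩, hl, hl₁, hs, hs₂⟩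

end Feasible

/-! ### The i.i.d. law is feasible -/

section Baseline

variable {𝒳 : Type*} [MeasurableSpace 𝒳] (μ : Measure 𝒳) [IsProbabilityMeasure μ] (T : ℕ)

lemma chiSq_self {E : Type*} [MeasurableSpace E] (ν : Measure E) [SigmaFinite ν] :
    chiSq ν ν = 0 := by
  rw [chiSq, if_pos Measure.AbsolutelyContinuous.rfl, ← lintegral_zero (μ := ν)]
  refine lintegral_congr_ae ?_
  filter_upwards [ν.rnDeriv_self] with e he
  simp [he]

lemma iIndepFun_eval_baseline :
    iIndepFun (fun (i : Fin T) (x : Fin T → 𝒳) => x i) (baseline μ T) :=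
  iIndepFun_pi (μ := fun _ : Fin T => μ) (X := fun _ x => x) fun _ => aemeasurable_id

lemma map_eval_baseline (i : Fin T) : (baseline μ T).map (fun x => x i) = μ :=
  (measurePreserving_eval (fun _ : Fin T => μ) i).map_eq

lemma condExp_cylinderEvents_baseline {Δ Δ' : Set (Fin T)} (hΔ : Disjoint Δ Δ')
    {A : Set (Fin T → 𝒳)} (hA : MeasurableSet[cylinderEvents (X := fun _ : Fin T => 𝒳) Δ] A) :
    (baseline μ T)[A.indicator (fun _ => (1 : ℝ)) | cylinderEvents (X := fun _ : Fin T => 𝒳) Δ']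
      =ᵐ[baseline μ T] fun _ => (baseline μ T).real A := by
  have h := condExp_indep_eq (μ := baseline μ T) (f := A.indicator (fun _ => (1 : ℝ)))
    cylinderEvents_le_pi cylinderEvents_le_pi
    ((measurable_const.indicator hA).stronglyMeasurable)
    (indep_iSup_of_disjoint (fun i => (measurable_pi_apply i).comap_le)
      (iIndepFun_eval_baseline μ T) hΔ)
  refine h.trans (ae_of_all _ fun _ => ?_)
  rw [integral_indicator_const _ (cylinderEvents_le_pi _ hA)]
  simp

/-- Past, present and future use disjoint coordinates, so all three conditional probabilities are
constants and the claim reduces to independence of past and future. -/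
lemma isDependent_baseline (p : ℕ) : IsDependent p (baseline μ T) := by
  intro t A B hA hB
  have hAB : MeasurableSet[cylinderEvents (X := fun _ : Fin T => 𝒳)
      ({s | (s : ℕ) < t} ∪ {s | t + p ≤ (s : ℕ)})] (A ∩ B) :=
    (cylinderEvents_mono Set.subset_union_left _ hA).inter
      (cylinderEvents_mono Set.subset_union_right _ hB)
  have d1 : Disjoint {s : Fin T | (s : ℕ) < t} {s : Fin T | t ≤ (s : ℕ) ∧ (s : ℕ) < t + p} :=
    Set.disjoint_left.2 fun s h1 h2 => by
      simp only [Set.mem_ofPred_eq] at h1 h2; omega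
  have d2 : Disjoint {s : Fin T | t + p ≤ (s : ℕ)}
      {s : Fin T | t ≤ (s : ℕ) ∧ (s : ℕ) < t + p} :=
    Set.disjoint_left.2 fun s h1 h2 => by
      simp only [Set.mem_ofPred_eq] at h1 h2; omega
  have d3 : Disjoint {s : Fin T | (s : ℕ) < t} {s : Fin T | t + p ≤ (s : ℕ)} :=
    Set.disjoint_left.2 fun s h1 h2 => by
      simp only [Set.mem_ofPred_eq] at h1 h2; omega
  have hind : Indep (cylinderEvents (X := fun _ : Fin T => 𝒳) {s | (s : ℕ) < t})
      (cylinderEvents (X := fun _ : Fin T => 𝒳) {s | t + p ≤ (s : ℕ)}) (baseline μ T) :=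
    indep_iSup_of_disjoint (fun i => (measurable_pi_apply i).comap_le)
      (iIndepFun_eval_baseline μ T) d3
  filter_upwards [condExp_cylinderEvents_baseline μ T (d1.union_left d2) hAB,
    condExp_cylinderEvents_baseline μ T d1 hA, condExp_cylinderEvents_baseline μ T d2 hB]
    with x h1 h2 h3
  rw [h1, Pi.mul_apply, h2, h3, Measure.real, Measure.real, Measure.real,
    (Indep_iff _ _ _).1 hind A B hA hB, ENNReal.toReal_mul]

lemma isStationary_baseline : IsStationary (baseline μ T) := by
  intro m s hs
  have key : ∀ g : Fin m → Fin T, Function.Injective g →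
      (baseline μ T).map (fun x (i : Fin m) => x (g i)) = Measure.pi fun _ => μ := by
    intro g hg
    have h := (iIndepFun_iff_map_fun_eq_pi_map (fun i => (measurable_pi_apply (g i)).aemeasurable)).1
      ((iIndepFun_eval_baseline μ T).precomp hg)
    simpa only [map_eval_baseline] using h
  rw [key (fun i => ⟨s + i, by omega⟩) fun i j hij => by
      simp only [Fin.mk.injEq] at hij; exact Fin.ext (by omega),
    key (fun i => ⟨i, by omega⟩) fun i j hij => by
      simp only [Fin.mk.injEq] at hij; exact Fin.ext hij]

/-- The i.i.d. law is its own 1-dependent counterpart and both χ² quantities vanish. This gives the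
nonemptiness needed to bound `sSup` and `sInf`. -/
lemma isFeasible_baseline (η₁ η₂ : ℝ) : IsFeasible μ η₁ η₂ (baseline μ T) where
  isProbabilityMeasure := inferInstance
  lagOne i j hij := by
    rw [map_eval_pair_baseline μ (fun h => by rw [h] at hij; omega), phiSq,
      measurePreserving_fst.map_eq, measurePreserving_snd.map_eq, chiSq_self]
    exact zero_le
  lagTwo := ⟨baseline μ T, ⟨inferInstance, isDependent_baseline μ T 1, fun _ _ _ => rfl⟩,
    fun i j k _ _ => by
      have : IsFiniteMeasure (tripleLaw (baseline μ T) i j k) := by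
        unfold tripleLaw; infer_instance
      rw [chiSq_self]
      exact zero_le⟩
  isDependent := isDependent_baseline μ T 2
  isStationary := isStationary_baseline μ T
  marginal := map_eval_baseline μ T
  absolutelyContinuous := Measure.AbsolutelyContinuous.rfl

end Baseline

lemma isLittleO_remainder (M N : ℝ) :
    Asymptotics.IsLittleO (𝓝[Set.Ici 0 ×ˢ Set.Ici 0] ((0, 0) : ℝ × ℝ))
      (fun η : ℝ × ℝ => M * √(N * (√η.1 + √η.2)) * (√η.1 + √η.2))
      (fun η => √η.1 + √η.2) := by
  have hc : Continuous fun η : ℝ × ℝ => M * √(N * (√η.1 + √η.2)) := by fun_prop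
  have ht : Filter.Tendsto (fun η : ℝ × ℝ => M * √(N * (√η.1 + √η.2)))
      (𝓝[Set.Ici 0 ×ˢ Set.Ici 0] ((0, 0) : ℝ × ℝ)) (𝓝 0) := by
    have := hc.tendsto (0, 0)
    simp only [Real.sqrt_zero, add_zero, mul_zero] at this
    exact this.mono_left nhdsWithin_le_nhds
  have := ((Asymptotics.isLittleO_one_iff ℝ).2 ht).mul_isBigO
    (Asymptotics.isBigO_refl (fun η : ℝ × ℝ => √η.1 + √η.2) _)
  simpa only [one_mul] using this

end SerialDependency

theorem theorem4 {𝒳 : Type*} [MeasurableSpace 𝒳] (μ : Measure 𝒳) [IsProbabilityMeasure μ]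
    (T : ℕ) (hT : 2 < T) (h : (Fin T → 𝒳) → ℝ) (h_meas : Measurable h)
    (h_bdd : ∃ C : ℝ, ∀ x, |h x| ≤ C) :
    (∀ η₁ η₂ : ℝ, 0 ≤ η₁ → 0 ≤ η₂ →
      (SerialDependency.values μ h η₁ η₂).Nonempty ∧
      BddAbove (SerialDependency.values μ h η₁ η₂) ∧
      BddBelow (SerialDependency.values μ h η₁ η₂)) ∧
    (∃ r : ℝ × ℝ → ℝ,
      Asymptotics.IsLittleO (𝓝[Set.Ici 0 ×ˢ Set.Ici 0] ((0, 0) : ℝ × ℝ)) r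
        (fun η => √η.1 + √η.2) ∧
      ∀ η₁ η₂ : ℝ, 0 ≤ η₁ → 0 ≤ η₂ →
        SerialDependency.maxValue μ h η₁ η₂ ≤
          SerialDependency.E0 μ h + √(SerialDependency.varR μ h * η₁)
            + √(SerialDependency.varS μ h * η₂) + r (η₁, η₂)) ∧
    (∃ r : ℝ × ℝ → ℝ,
      Asymptotics.IsLittleO (𝓝[Set.Ici 0 ×ˢ Set.Ici 0] ((0, 0) : ℝ × ℝ)) r
        (fun η => √η.1 + √η.2) ∧
      ∀ η₁ η₂ : ℝ, 0 ≤ η₁ → 0 ≤ η₂ →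
        SerialDependency.minValue μ h η₁ η₂ ≥
          SerialDependency.E0 μ h - √(SerialDependency.varR μ h * η₁)
            - √(SerialDependency.varS μ h * η₂) + r (η₁, η₂)) := by
  open SerialDependency in
  obtain ⟨C, hC⟩ := h_bdd
  have : NeZero T := ⟨by omega⟩
  have hne : Nonempty (Fin T → 𝒳) := (baseline μ T).nonempty_of_neZero
  have hC0 : 0 ≤ C := (abs_nonneg _).trans (hC hne.some)
  have nonempty : ∀ η₁ η₂, (values μ h η₁ η₂).Nonempty := fun η₁ η₂ =>
    ⟨_, baseline μ T, isFeasible_baseline μ T η₁ η₂, rfl⟩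
  have bound : ∀ η₁ η₂, ∀ v ∈ values μ h η₁ η₂, |v| ≤ C := by
    rintro η₁ η₂ _ ⟨P, hP, rfl⟩
    have := hP.isProbabilityMeasure
    simpa using norm_integral_le_of_norm_le_const (μ := P) (f := h) (ae_of_all _ hC)
  -- The bound is two-sided and its remainder does not depend on the feasible law, so it passes to
  -- both the supremum and the infimum, with the remainder negated for the latter.
  have main : ∀ η₁ η₂, 0 ≤ η₁ → 0 ≤ η₂ → ∀ v ∈ values μ h η₁ η₂,
      |v - E0 μ h| ≤ √(varR μ h * η₁) + √(varS μ h * η₂)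
        + 10 * (T * C) * √(T * (√η₁ + √η₂)) * (√η₁ + √η₂) := by
    rintro η₁ η₂ hη₁ hη₂ _ ⟨P, hP, rfl⟩
    have := hP.isProbabilityMeasure
    obtain ⟨L, V, hLV, hl, hl₁, hs, hs₂⟩ := hP.exists_isChainLaw hT hη₁ hη₂
    exact hLV.abs_integral_sub_le hT hη₁ hη₂ hl hl₁ hs hs₂ h_meas hC0 hC
  refine ⟨fun η₁ η₂ _ _ => ⟨nonempty η₁ η₂, ⟨C, fun v hv => (abs_le.1 (bound η₁ η₂ v hv)).2⟩,
    ⟨-C, fun v hv => (abs_le.1 (bound η₁ η₂ v hv)).1⟩⟩,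
    ⟨_, isLittleO_remainder (10 * (T * C)) T, fun η₁ η₂ hη₁ hη₂ => ?_⟩,
    ⟨_, (isLittleO_remainder (10 * (T * C)) T).neg_left, fun η₁ η₂ hη₁ hη₂ => ?_⟩⟩
  · refine csSup_le (nonempty η₁ η₂) fun v hv => ?_
    linarith [(abs_le.1 (main η₁ η₂ hη₁ hη₂ v hv)).2]
  · refine le_csInf (nonempty η₁ η₂) fun v hv => ?_
    linarith [(abs_le.1 (main η₁ η₂ hη₁ hη₂ v hv)).1]
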